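/- **Setting.** Let $c,d,s\ge 1$ and $b,r\ge 0$ be integers. Let $\Sigma=\{0,1\}^b$, identified with $\{0,\dots,2^b-1\}$ by binary expansion, let $\oplus$ be bitwise XOR, and let $s\le|\Sigma|$ and $m=s2^r$, so that $[m/s]=\{0,1\}^r$ and $[s]=\{0,\dots,s-1\}\subseteq\Sigma$. Keys are $x=(x_0,\dots,x_{c-1})\in\Sigma^c$. A simple tabulation function is $g(x)=\bigoplus_k T_k[x_k]$ (a product of table entries for sign functions) with independent, uniformly random table entries; $g_I$ uses only the positions $k\in I$. Let $h_1:\Sigma^c\to[m/s]$, $\sigma_1:\Sigma^c\to\{-1,1\}$, $h_2:\Sigma^c\to\Sigma^d$, $h_3:\Sigma^d\to[m/s]$, $\sigma_3:\Sigma^d\to\{-1,1\}$ be independent simple tabulation functions. Mixed Tabulation is, for $i\in[s]$, $$h(i,x)=h_1(x)\oplus h_3\big(h_2(x)\oplus(i,\dots,i)\big),\qquad \sigma(i,x)=\sigma_1(x)\,\sigma_3\big(h_2(x)\oplus(i,\dots,i)\big).$$ For a unit vector $w\in\mathbb R^{\Sigma^c}$ let $$Z=\frac1s\sum_{i\in[s]}\sum_{x\ne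 y}\sigma(i,x)\sigma(i,y)\mathbf 1[h(i,x)=h(i,y)]\,w_xw_y .$$ Let $\pi$ range over all partial keys $\{(k,\alpha_k)\}_{k\in I_\pi}$ with $I_\pi\subseteq[c]$, $\alpha_k\in\Sigma$ (including the empty one), and let $\tau$ range over all prefixes of length $|\tau|\in\{0,\dots,d-1\}$ of elements of $\Sigma^d$. Put $U_{\pi,\tau}=\{x\in\Sigma^c:\pi\subseteq x,\ \tau\subseteq h_2(x)\}$. For $I\subseteq[c]$ and $t\in[d]$, with $h_2^{D}$ the part of $h_2$ in the coordinates $D\subseteq[d]$, $h_{3,D}$ and $\sigma_{3,D}$ the parts of $h_3$ and $\sigma_3$ that use the positions $D$, and complements written $^{\mathsf c}$, let $$h_{I,t}(i,x)=h_{1,I}(x)\oplus h_{3,\{t\}}\big(h_{2,I}^{\{t\}}(x)\oplus i\oplus h_{2,I^{\mathsf c}}^{\{t\}}(x)\big)\oplus h_{1,I^{\mathsf c}}(x)\oplus h_{3,\{t\}^{\mathsf c}}\big(h_2^{\{t\}^{\mathsf c}}(x)\oplus(i,\dots,i)\big),$$ and let $\overline{h_{I,t}}$ be obtained from it by replacing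 $h_{1,I}$, $h_{2,I}^{\{t\}}$ and $h_{3,\{t\}}$ by those of an independent copy of all tables. Define $\sigma_{I,t}$ and $\overline{\sigma_{I,t}}$ in the same way from $\sigma_1,\sigma_3,h_2$ (with products for $\sigma$). **Decoupling-decompositions.** Let $\|X\|_p=\mathbb E[|X|^p]^{1/p}$, and fix $\varepsilon>0$. A finite collection of random sets $(U_\alpha)$ of keys is a $(p,L,\gamma)$-*decoupling-decomposition* (at error level $\varepsilon$) of $(h,\sigma)$ for a property $P$ of random pairs (hash function, sign function) if there are random functions $h_\alpha,h'_\alpha:[s]\times U_\alpha\to[m/s]$ and $\sigma_\alpha,\sigma'_\alpha:[s]\times U_\alpha\to\{-1,1\}$ such that for all unit vectors $w$ $$\Pr[|Z|\ge\varepsilon]\le\Big(\varepsilon^{-1}\sum_\alpha\frac Ls\Big\|\sum_{i\in[s]}\sum_{x,y\in U_\alpha}\sigma_\alpha(i,x)\sigma'_\alpha(i,y)\mathbf 1[h_\alpha(i,x)=h'_\alpha(i,y)]w_xw_y\Big\|_p\Big)^p+\gamma ,$$ $(h_\alpha,\sigma_\alpha)$ and $(h'_\alpha,\sigma'_\alpha)$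 have the same distribution (as functions on the random set $U_\alpha$), and $(h_\alpha,\sigma_\alpha)$ has property $P$ when conditioned on $(h'_\alpha,\sigma'_\alpha)$ and $U_\alpha$. **Lemma.** Let $p\ge2$, $\varepsilon>0$ and $\gamma=4\varepsilon^{-2}3^c\frac sm|\Sigma|^{-d}$. 1. For either choice $J_\pi=I_\pi$ (for all $\pi$) or $J_\pi=[c]\setminus I_\pi$ (for all $\pi$), and for every unit vector $w$, $$\Pr[|Z|\ge\varepsilon]\le\Big(\varepsilon^{-1}\sum_\pi\sum_\tau\frac{4^{c+4}}s\Big\|\sum_{i\in[s]}\sum_{x,y\in U_{\pi,\tau}}\sigma_{J_\pi,|\tau|}(i,x)\,\overline{\sigma_{J_\pi,|\tau|}}(i,y)\,\mathbf 1\big[h_{J_\pi,|\tau|}(i,x)=\overline{h_{J_\pi,|\tau|}}(i,y)\big]w_xw_y\Big\|_p\Big)^p+\gamma .$$ 2. For every outcome of the tables and every $w\in\mathbb R^{\Sigma^c}$, $\ \sum_\pi\sum_\tau\sum_{x\in U_{\pi,\tau}}w_x^2\le d\,2^c\,\|w\|_2^2$. 3. $(U_{\pi,\tau})$ is a $(p,4^{c+2},\gamma)$-decoupling-decomposition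 of Mixed Tabulation for every property $P$ that holds, on every set $V$ of keys that all contain a common partial key $\pi$, for every mixture of distributions of pairs of the form $$\big(a(i,x)\oplus h_{1,I}(x)\oplus h_3(h_{2,I}(x)\oplus i),\ \ e(i,x)\,\sigma_{1,I}(x)\,\sigma_3(h_{2,I}(x)\oplus i)\big),\qquad I=[c]\setminus I_\pi,$$ that is, Mixed Tabulation on the remaining characters with one derived character, with fixed offsets $a:[s]\times V\to[m/s]$ and $e:[s]\times V\to\{-1,1\}$. -/

import Mathlib

open MeasureTheory ProbabilityTheory

namespace SparseJL

noncomputable section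

/-! ### Norms, the error variable and decoupling-decompositions for general hash functions -/

/-- The `p`-norm `E[|X|^p]^(1/p)` of a real random variable. -/
def pNorm {Ω : Type*} [MeasurableSpace Ω] (μ : Measure Ω) (p : ℝ) (X : Ω → ℝ) : ℝ :=
  (∫ ω, |X ω| ^ p ∂μ) ^ (1 / p)

/-- A sign in `{-1, 1}`, as a real number. -/
def sgn (e : ℤˣ) : ℝ := ((e : ℤ) : ℝ)

/-- The error `Z` of the sparse Johnson-Lindenstrauss transform given by the hash function
`h : [s] × K → B` and the sign function `σ : [s] × K → {-1, 1}`, on the vector `w`: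
`(1/s) ∑_i ∑_{x ≠ y} σ(i,x) σ(i,y) 1[h(i,x) = h(i,y)] w_x w_y`. -/
def errorZ {K B : Type*} [Fintype K] [DecidableEq K] [DecidableEq B] {s : ℕ}
    (h : Fin s → K → B) (σ : Fin s → K → ℤˣ) (w : K → ℝ) : ℝ :=
  (1 / (s : ℝ)) * ∑ i, ∑ x, ∑ y, if x ≠ y then
    sgn (σ i x) * sgn (σ i y) * (if h i x = h i y then 1 else 0) * w x * w y else 0

/-- `∑_i ∑_{x, y ∈ U} σ(i,x) σ'(i,y) 1[h(i,x) = h'(i,y)] w_x w_y`. -/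
def decoupledSum {K B : Type*} [DecidableEq B] {s : ℕ} (U : Finset K)
    (h : Fin s → K → B) (σ : Fin s → K → ℤˣ) (h' : Fin s → K → B) (σ' : Fin s → K → ℤˣ)
    (w : K → ℝ) : ℝ :=
  ∑ i, ∑ x ∈ U, ∑ y ∈ U,
    sgn (σ i x) * sgn (σ' i y) * (if h i x = h' i y then 1 else 0) * w x * w y

/-- A hash function `[s] × V → B` together with a sign function `[s] × V → {-1, 1}`. -/
abbrev PairOn (s : ℕ) {K : Type*} (V : Finset K) (B : Type*) : Type _ :=
  (Fin s → V → B) × (Fin s → V → ℤˣ)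

/-- The restriction of `(h, σ)` to the keys in `V`. -/
def restrictPair {K B : Type*} {s : ℕ} (V : Finset K) (h : Fin s → K → B)
    (σ : Fin s → K → ℤˣ) : PairOn s V B :=
  (fun i x => h i x, fun i x => σ i x)

/-- A property of random pairs (hash function, sign function) on a set `V` of keys.  It is a
property of the distribution, which is given by its probability mass function. -/
abbrev PairProperty (s : ℕ) (K B : Type*) : Type _ :=
  (V : Finset K) → (PairOn s V B → ℝ) → Prop

/-- The pairs `(h, σ)` and `(h', σ')`, as random functions on the random set `U` of keys, have
the same distribution. -/
def SameLawOn {Ω K B : Type*} [MeasurableSpace Ω] {s : ℕ} (μ : Measure Ω) (U : Ω → Finset K)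
    (h : Ω → Fin s → K → B) (σ : Ω → Fin s → K → ℤˣ)
    (h' : Ω → Fin s → K → B) (σ' : Ω → Fin s → K → ℤˣ) : Prop :=
  ∀ (V : Finset K) (g : PairOn s V B),
    μ {ω | U ω = V ∧ restrictPair V (h ω) (σ ω) = g} =
      μ {ω | U ω = V ∧ restrictPair V (h' ω) (σ' ω) = g}

/-- The pair `(h, σ)` on the random set `U` of keys satisfies the property `P` when conditioned
on the pair `(h', σ')` on `U` and on `U`: so does its conditional distribution, for every value
of `U` and `(h', σ')` that has positive probability. -/
def SatisfiesGiven {Ω K B : Type*} [MeasurableSpace Ω] {s : ℕ} (μ : Measure Ω)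
    (P : PairProperty s K B) (U : Ω → Finset K)
    (h : Ω → Fin s → K → B) (σ : Ω → Fin s → K → ℤˣ)
    (h' : Ω → Fin s → K → B) (σ' : Ω → Fin s → K → ℤˣ) : Prop :=
  ∀ (V : Finset K) (g : PairOn s V B),
    μ {ω | U ω = V ∧ restrictPair V (h' ω) (σ' ω) = g} ≠ 0 →
    P V (fun q => (μ[|{ω | U ω = V ∧ restrictPair V (h' ω) (σ' ω) = g}]).real
      {ω | restrictPair V (h ω) (σ ω) = q})

/-- The collection `U` of random sets of keys is a `(p, L, γ)`-decoupling-decomposition, at the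
error level `ε`, of the pair `(h, σ)` for the property `P`.  The functions `hd α`, `σd α`,
`hd' α`, `σd' α` matter only on the keys in `U α`. -/
def IsDecouplingDecomposition {Ω K B A : Type*} [MeasurableSpace Ω] [Fintype K] [DecidableEq K]
    [DecidableEq B] [Fintype A] {s : ℕ} (μ : Measure Ω)
    (h : Ω → Fin s → K → B) (σ : Ω → Fin s → K → ℤˣ) (P : PairProperty s K B)
    (ε p L γ : ℝ) (U : A → Ω → Finset K) : Prop :=
  ∃ (hd : A → Ω → Fin s → K → B) (σd : A → Ω → Fin s → K → ℤˣ)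
    (hd' : A → Ω → Fin s → K → B) (σd' : A → Ω → Fin s → K → ℤˣ),
    (∀ w : K → ℝ, ∑ x, w x ^ 2 = 1 →
      μ.real {ω | ε ≤ |errorZ (h ω) (σ ω) w|} ≤
        (ε⁻¹ * ∑ α, L / s * pNorm μ p (fun ω =>
          decoupledSum (U α ω) (hd α ω) (σd α ω) (hd' α ω) (σd' α ω) w)) ^ p + γ) ∧
    (∀ α, SameLawOn μ (U α) (hd α) (σd α) (hd' α) (σd' α)) ∧
    (∀ α, SatisfiesGiven μ P (U α) (hd α) (σd α) (hd' α) (σd' α))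

/-! ### Mixed Tabulation hashing -/

/-- Bit strings of length `n`, identified with `{0, …, 2^n - 1}`.  Addition is bitwise XOR. -/
abbrev Bits (n : ℕ) : Type := Fin n → ZMod 2

/-- The binary expansion of `i`, least significant bit first. -/
def bitsOf (n i : ℕ) : Bits n := fun k => if i.testBit k then 1 else 0

/-- Keys `x = (x_0, …, x_{c-1})` over the alphabet `Bits b`. -/
abbrev Key (b c : ℕ) : Type := Fin c → Bits b

/-- The tables of a Mixed Tabulation hash function `h(i,x) = h₁(x) ⊕ h₃(h₂(x) ⊕ (i,…,i))` and
sign function `σ(i,x) = σ₁(x) σ₃(h₂(x) ⊕ (i,…,i))`: `h1`, `s1` and `h2` for the `c` characters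
of the key, `h3` and `s3` for the `d` derived characters. -/
structure MixedTables (b r c d : ℕ) where
  h1 : Fin c → Bits b → Bits r
  s1 : Fin c → Bits b → ℤˣ
  h2 : Fin c → Bits b → (Fin d → Bits b)
  h3 : Fin d → Bits b → Bits r
  s3 : Fin d → Bits b → ℤˣ

/-- All subsets of the (finite) space of tables are measurable. -/
instance (b r c d : ℕ) : MeasurableSpace (MixedTables b r c d) := ⊤

instance (b r c d : ℕ) : DiscreteMeasurableSpace (MixedTables b r c d) := ⟨fun _ => trivial⟩

instance (b r c d : ℕ) : Inhabited (MixedTables b r c d) :=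
  ⟨⟨fun _ _ => 0, fun _ _ => 1, fun _ _ => 0, fun _ _ => 0, fun _ _ => 1⟩⟩

instance (b r c d : ℕ) : Finite (MixedTables b r c d) := by
  have e1 : Finite (Fin c → Bits b → Bits r) := inferInstance
  have e2 : Finite (Fin c → Bits b → ℤˣ) := inferInstance
  have e3 : Finite (Fin c → Bits b → (Fin d → Bits b)) := inferInstance
  have e4 : Finite (Fin d → Bits b → Bits r) := inferInstance
  have e5 : Finite (Fin d → Bits b → ℤˣ) := inferInstance
  have e6 := @Finite.instProd _ _ e3 (@Finite.instProd _ _ e4 e5)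
  have e7 := @Finite.instProd _ _ e1 (@Finite.instProd _ _ e2 e6)
  refine @Finite.of_injective _ _ e7
    (fun T : MixedTables b r c d => (T.h1, T.s1, T.h2, T.h3, T.s3)) fun T T' h => ?_
  cases T; cases T'; simpa using h

/-- All table entries are independent and uniformly random. -/
def tablesMeasure (b r c d : ℕ) : Measure (MixedTables b r c d) := uniformOn Set.univ

instance (b r c d : ℕ) : IsProbabilityMeasure (tablesMeasure b r c d) :=
  isProbabilityMeasure_uniformOn Set.finite_univ Set.univ_nonempty

/-- A pair of tables: the tables of the hash function, and an independent copy of them. -/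
def pairMeasure (b r c d : ℕ) : Measure (MixedTables b r c d × MixedTables b r c d) :=
  (tablesMeasure b r c d).prod (tablesMeasure b r c d)

namespace MixedTables

variable {b r c d : ℕ}

/-- `h_{1,I}(x)`: simple tabulation with the positions in `I` only. -/
def hash1 (T : MixedTables b r c d) (I : Finset (Fin c)) (x : Key b c) : Bits r :=
  ∑ k ∈ I, T.h1 k (x k)

/-- `σ_{1,I}(x)`. -/
def sign1 (T : MixedTables b r c d) (I : Finset (Fin c)) (x : Key b c) : ℤˣ :=
  ∏ k ∈ I, T.s1 k (x k)

/-- `h_{2,I}(x)`. -/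
def hash2 (T : MixedTables b r c d) (I : Finset (Fin c)) (x : Key b c) : Fin d → Bits b :=
  ∑ k ∈ I, T.h2 k (x k)

/-- `h_{3,D}(z)`; it reads `z` only at the positions in `D`. -/
def hash3 (T : MixedTables b r c d) (D : Finset (Fin d)) (z : Fin d → Bits b) : Bits r :=
  ∑ k ∈ D, T.h3 k (z k)

/-- `σ_{3,D}(z)`. -/
def sign3 (T : MixedTables b r c d) (D : Finset (Fin d)) (z : Fin d → Bits b) : ℤˣ :=
  ∏ k ∈ D, T.s3 k (z k)

/-- The Mixed Tabulation hash function `h : [s] × Σ^c → [2^r]`. -/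
def hash {s : ℕ} (T : MixedTables b r c d) (i : Fin s) (x : Key b c) : Bits r :=
  T.hash1 .univ x + T.hash3 .univ (fun k => T.hash2 .univ x k + bitsOf b i)

/-- The Mixed Tabulation sign function `σ : [s] × Σ^c → {-1, 1}`. -/
def sign {s : ℕ} (T : MixedTables b r c d) (i : Fin s) (x : Key b c) : ℤˣ :=
  T.sign1 .univ x * T.sign3 .univ (fun k => T.hash2 .univ x k + bitsOf b i)

/-- Mixed Tabulation with two sets of tables: `F` supplies the tables `h₁`, `σ₁`, and `h₂` for
the derived character `t`, at the positions in `I`, and the tables `h₃`, `σ₃` of the derived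
character `t`; `T` supplies everything else.  `T.decHash T I t` is `h_{I,t}`, and
`T.decHash F I t` with an independent copy `F` of `T` is its overlined version. -/
def decHash {s : ℕ} (T F : MixedTables b r c d) (I : Finset (Fin c)) (t : Fin d)
    (i : Fin s) (x : Key b c) : Bits r :=
  (F.hash1 I x + F.hash3 {t} (fun k => F.hash2 I x k + bitsOf b i + T.hash2 Iᶜ x k)) +
    (T.hash1 Iᶜ x + T.hash3 {t}ᶜ (fun k => T.hash2 .univ x k + bitsOf b i))

/-- The sign function that belongs to `decHash`. -/
def decSign {s : ℕ} (T F : MixedTables b r c d) (I : Finset (Fin c)) (t : Fin d)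
    (i : Fin s) (x : Key b c) : ℤˣ :=
  (F.sign1 I x * F.sign3 {t} (fun k => F.hash2 I x k + bitsOf b i + T.hash2 Iᶜ x k)) *
    (T.sign1 Iᶜ x * T.sign3 {t}ᶜ (fun k => T.hash2 .univ x k + bitsOf b i))

end MixedTables

/-- Partial keys `π = {(k, α_k)}_{k ∈ I}` with `I ⊆ [c]`: `π k = some α_k` if `k ∈ I`, and
`π k = none` otherwise. -/
abbrev PartialKey (b c : ℕ) : Type := Fin c → Option (Bits b)

/-- The set `I_π` of positions of `π`. -/
def PartialKey.positions {b c : ℕ} (π : PartialKey b c) : Finset (Fin c) :=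
  Finset.univ.filter fun k => (π k).isSome

/-- `π ⊆ x`. -/
def PartialKey.Sub {b c : ℕ} (π : PartialKey b c) (x : Key b c) : Prop :=
  ∀ k a, π k = some a → x k = a

/-- Prefixes `τ` of length `|τ| = τ.1 < d` of derived keys in `Σ^d`. -/
abbrev Prefix (b d : ℕ) : Type := (t : Fin d) × (Fin t → Bits b)

/-- `τ ⊆ z`. -/
def Prefix.Sub {b d : ℕ} (τ : Prefix b d) (z : Fin d → Bits b) : Prop :=
  ∀ k : Fin τ.1, z (Fin.castLE τ.1.is_lt.le k) = τ.2 k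

open Classical in
/-- The random set `U_{π,τ} = {x | π ⊆ x, τ ⊆ h₂(x)}`. -/
def keySet {b r c d : ℕ} (π : PartialKey b c) (τ : Prefix b d) (T : MixedTables b r c d) :
    Finset (Key b c) :=
  Finset.univ.filter fun x => π.Sub x ∧ τ.Sub (T.hash2 .univ x)

/-- The probability mass function, on the keys in `V`, of Mixed Tabulation that uses the positions
in `I` and one derived character, shifted by the fixed offsets `a` and `e`:
`h(i,x) = a(i,x) ⊕ h₁(x) ⊕ h₃(h₂(x) ⊕ i)` and `σ(i,x) = e(i,x) σ₁(x) σ₃(h₂(x) ⊕ i)`. -/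
def offsetLaw {b r c s : ℕ} (I : Finset (Fin c)) (a : Fin s → Key b c → Bits r)
    (e : Fin s → Key b c → ℤˣ) (V : Finset (Key b c)) (q : PairOn s V (Bits r)) : ℝ :=
  (tablesMeasure b r c 1).real {T | restrictPair V
    (fun i x => a i x + (T.hash1 I x + T.hash3 .univ (fun k => T.hash2 I x k + bitsOf b i)))
    (fun i x => e i x * (T.sign1 I x * T.sign3 .univ (fun k => T.hash2 I x k + bitsOf b i))) = q}

/-- The keys in `V` share a partial key `π`, and `f` is a mixture of distributions of offset Mixed
Tabulation functions that use the remaining positions and one derived character. -/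
def IsOffsetMixedTabulation {b r c s : ℕ} : PairProperty s (Key b c) (Bits r) :=
  fun V f => ∃ π : PartialKey b c, (∀ x ∈ V, π.Sub x) ∧
    f ∈ convexHull ℝ {g | ∃ a e, g = offsetLaw π.positionsᶜ a e V}

end

end SparseJL

namespace SparseJL

open MixedTables

/-! Split the pairs of keys in `Z` by whether they collide under `h₂`. If `h₂ x = h₂ y`, the
contributions of `h₃` and `σ₃` cancel, so the term does not depend on `i`, and these pairs sum to
`collideSum`. Expanding its square, the expectation of four signs vanishes unless at every position
the four characters form two equal pairs. There are three pairings per position, and Cauchy–Schwarz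
bounds the weighted count by `3 ^ c` (`sum_forall_paired_le`). Distinct keys collide under `(h₁,
h₂)` with probability `2^{-r} |Σ|^{-d}`, so Chebyshev at `ε / 2` gives `γ`.

Every other pair lies in exactly one class: `π` collects the common characters of `x` and `y`, and
`τ` is the longest common prefix of `h₂ x` and `h₂ y`. Within a class the keys differ at each
position outside `I_π`, and the derived keys differ at coordinate `|τ|`, so the two keys read
different entries of each of these tables. The random signs give every term mean zero in each entry,
and the standard decoupling argument (`sum_abs_rpow_decouple`) passes to an independent copy of one
table at a time, at a factor 4 in the norm. The set `U_{π,τ}` reads only the coordinates of `h₂`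
before `|τ|`; decoupling `h₂` in coordinate `|τ|` alone therefore leaves it unchanged. At most `c +
1` tables are decoupled, and the split at `ε / 2` costs a factor 2. For `J_π = I_π` the empty `π`
alone covers all pairs.

For the laws, the overlined functions are the original ones evaluated at `mix`, which exchanges a
block of entries between two independent tables; this preserves the measure and `U_{π,τ}`. Given
`U_{π,τ}` and the overlined pair, the exchanged block of the original tables is still uniform. With
everything else fixed, the original pair is an offset Mixed Tabulation with one derived character:
all keys contain `π`, so the part of `h₂` on `I_π` is a constant that a shift of `h₃` absorbs. -/

/-! ### Decoupling of quadratic forms in independent uniform entries. -/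

/-- Exchanging a block of `x` with `y` is an involution of the product. This is the finite form of
resampling a block of independent uniform variables; all changes of variables for the tables, apart
from sign flips and the shift of `h₃`, go through it. -/
theorem sum_sum_resample {X Y M : Type*} [Fintype X] [Fintype Y] [AddCommMonoid M]
    (put : X → Y → X) (get : X → Y → Y) (h1 : ∀ x y, put (put x y) (get x y) = x)
    (h2 : ∀ x y, get (put x y) (get x y) = y) (G : X → Y → M) :
    ∑ x, ∑ y, G (put x y) (get x y) = ∑ x, ∑ y, G x y := by
  rw [← Fintype.sum_prod_type', ← Fintype.sum_prod_type']
  have hinv : Function.Involutive fun q : X × Y => (put q.1 q.2, get q.1 q.2) := fun q => by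
    ext <;> simp [h1, h2]
  exact Equiv.sum_comp hinv.toPerm fun q : X × Y => G q.1 q.2

theorem sum_sum_update {α β M : Type*} [Fintype α] [DecidableEq α] [Fintype β] [AddCommMonoid M]
    (a : α) (G : (α → β) → M) :
    ∑ f : α → β, ∑ v, G (Function.update f a v) = Fintype.card β • ∑ f, G f := by
  have h := sum_sum_resample (fun (f : α → β) v => Function.update f a v) (fun f _ => f a)
    (fun f v => by simp) (fun f v => by simp) (fun f _ => G f)
  rw [h]
  simp [Finset.smul_sum]

theorem sum_eq_zero_of_sum_update {α β : Type*} [Fintype α] [DecidableEq α] [Fintype β]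
    [Nonempty β] (a : α) (G : (α → β) → ℝ) (h : ∀ f, ∑ v, G (Function.update f a v) = 0) :
    ∑ f, G f = 0 := by
  have h' := sum_sum_update a G
  simp only [h, Finset.sum_const_zero, nsmul_eq_mul] at h'
  have : (Fintype.card β : ℝ) ≠ 0 := by exact_mod_cast Fintype.card_ne_zero
  simpa [this] using h'.symm

/-- Two distinct fair bits take a prescribed pair of values with probability `1 / 4`; this is the
source of the factor 4 in the decoupling. -/
theorem sum_ite_true_false {α : Type*} [Fintype α] [DecidableEq α] {a a' : α} (h : a ≠ a') :
    4 * ∑ δ : α → Bool, (if δ a = true ∧ δ a' = false then (1 : ℝ) else 0) =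
      Fintype.card (α → Bool) := by
  have h1 := sum_sum_update (β := Bool) a
    fun δ => (if δ a = true ∧ δ a' = false then (1 : ℝ) else 0)
  have h2 := sum_sum_update (β := Bool) a' fun δ => (if δ a' = false then (1 : ℝ) else 0)
  simp only [Fintype.sum_bool, Function.update_self, Function.update_of_ne h.symm, true_and,
    Bool.false_eq_true, Bool.true_eq_false, false_and, if_false, if_true, add_zero, zero_add,
    Fintype.card_bool, nsmul_eq_mul, Finset.sum_const, Finset.card_univ, mul_one] at h1 h2
  push_cast at h1 h2
  linarith

/-- Jensen's inequality for the `p`-th power under the uniform distribution on `I`, with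
denominators cleared. -/
theorem card_mul_abs_rpow_le {I : Type*} [Fintype I] [Nonempty I] {p c x : ℝ} (hp : 1 ≤ p)
    (hc : 0 ≤ c) (y : I → ℝ) (h : Fintype.card I * x = c * ∑ i, y i) :
    Fintype.card I * |x| ^ p ≤ c ^ p * ∑ i, |y i| ^ p := by
  have hn : (0 : ℝ) < Fintype.card I := by exact_mod_cast Fintype.card_pos
  have h1 : (Fintype.card I * |x|) ^ p ≤ (c * ∑ i, |y i|) ^ p := by
    refine Real.rpow_le_rpow (by positivity) ?_ (by linarith)
    rw [← abs_of_pos hn, ← abs_mul, h, abs_mul, abs_of_nonneg hc]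
    gcongr
    exact Finset.abs_sum_le_sum_abs _ _
  have h2 := Real.rpow_sum_le_const_mul_sum_rpow Finset.univ y hp
  rw [Finset.card_univ] at h2
  rw [Real.mul_rpow hn.le (abs_nonneg _), Real.mul_rpow hc (by positivity)] at h1
  have h3 : (Fintype.card I : ℝ) ^ p = (Fintype.card I : ℝ) ^ (p - 1) * Fintype.card I := by
    rw [← Real.rpow_add_one hn.ne']; simp
  have hq : (0 : ℝ) < (Fintype.card I : ℝ) ^ (p - 1) := Real.rpow_pos_of_pos hn _
  have h4 : (Fintype.card I : ℝ) ^ (p - 1) * (Fintype.card I * |x| ^ p) ≤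
      (Fintype.card I : ℝ) ^ (p - 1) * (c ^ p * ∑ i, |y i| ^ p) := by
    calc _ = (Fintype.card I : ℝ) ^ p * |x| ^ p := by rw [h3]; ring
      _ ≤ c ^ p * (∑ i, |y i|) ^ p := h1
      _ ≤ c ^ p * ((Fintype.card I : ℝ) ^ (p - 1) * ∑ i, |y i| ^ p) := by gcongr
      _ = _ := by ring
  exact le_of_mul_le_mul_left h4 hq

/-- The function that agrees with `f` where `δ` holds and with `g` elsewhere. -/
def blend {α β : Type*} (δ : α → Bool) (f g : α → β) : α → β := fun a => if δ a then f a else g a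

/-- Averaging over the complementary entries leaves only the terms that read `f` twice. -/
theorem sum_blend_eq {α β ι : Type*} [Fintype α] [DecidableEq α] [Fintype β] [Nonempty β]
    (s : Finset ι) (l r : ι → α) (G : ι → β → β → ℝ) (hl : ∀ j v', ∑ v, G j v v' = 0)
    (hr : ∀ j v, ∑ v', G j v v' = 0) (δ : α → Bool) (f : α → β) :
    ∑ g, ∑ j ∈ s, G j (blend δ f g (l j)) (blend δ g f (r j)) =
      Fintype.card (α → β) * ∑ j ∈ s, (if δ (l j) = true ∧ δ (r j) = false then (1 : ℝ) else 0) *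
        G j (f (l j)) (f (r j)) := by
  rw [Finset.sum_comm, Finset.mul_sum]
  refine Finset.sum_congr rfl fun j _ => ?_
  -- A term that reads some entry of `g` vanishes on resampling that entry. If both entries come
  -- from `g`, they are distinct because `δ` differs at them, so one can be resampled alone.
  cases h1 : δ (l j) <;> cases h2 : δ (r j)
  · simp only [blend, h1, h2]
    simp only [Bool.false_eq_true, if_false, false_and, zero_mul, mul_zero]
    exact sum_eq_zero_of_sum_update (l j) _ fun g => by simp [hl]
  · have hne : l j ≠ r j := fun h => by simp [h, h2] at h1
    simp only [blend, h1, h2]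
    simp only [Bool.false_eq_true, if_false, false_and, zero_mul, mul_zero, if_true]
    exact sum_eq_zero_of_sum_update (l j) _ fun g => by simp [hl, hne.symm]
  · simp [blend, h1, h2]
  · simp only [blend, h1, h2]
    simp only [if_true, Bool.true_eq_false, and_false, if_false, zero_mul, mul_zero]
    exact sum_eq_zero_of_sum_update (r j) _ fun g => by simp [hr]

/-- Decoupling of the off-diagonal part of a quadratic form in independent uniform variables,
whose terms have mean zero in both variables. -/
theorem sum_abs_rpow_decouple {α β ι : Type*} [Fintype α] [DecidableEq α] [Fintype β] [Nonempty β]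
    {p : ℝ} (hp : 1 ≤ p) (s : Finset ι) (l r : ι → α) (G : ι → β → β → ℝ)
    (hl : ∀ j v', ∑ v, G j v v' = 0) (hr : ∀ j v, ∑ v', G j v v' = 0) :
    Fintype.card (α → β) *
        ∑ f : α → β, |∑ j ∈ s with l j ≠ r j, G j (f (l j)) (f (r j))| ^ p ≤
      4 ^ p * ∑ f : α → β, ∑ g : α → β, |∑ j ∈ s, G j (f (l j)) (g (r j))| ^ p := by
  set Ψ : (α → β) → (α → β) → ℝ := fun f g => ∑ j ∈ s, G j (f (l j)) (g (r j)) with hΨ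
  -- Jensen over `(δ, g)`: the off-diagonal form at `f` is 4 times the average of the blended form.
  -- The diagonal terms of `Ψ` average to zero, so `Ψ` may run over all of `s`.
  have key : ∀ f : α → β, Fintype.card ((α → Bool) × (α → β)) *
      |∑ j ∈ s with l j ≠ r j, G j (f (l j)) (f (r j))| ^ p ≤
      4 ^ p * ∑ q : (α → Bool) × (α → β), |Ψ (blend q.1 f q.2) (blend q.1 q.2 f)| ^ p := by
    intro f
    refine card_mul_abs_rpow_le hp (by norm_num) _ ?_
    rw [Fintype.sum_prod_type]
    simp only [hΨ]
    simp only [sum_blend_eq s l r G hl hr]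
    rw [← Finset.mul_sum, Finset.sum_comm]
    simp only [← Finset.sum_mul]
    rw [Fintype.card_prod, Nat.cast_mul, mul_left_comm (4 : ℝ),
      mul_comm (Fintype.card (α → Bool) : ℝ), mul_assoc]
    congr 1
    rw [Finset.sum_filter, Finset.mul_sum, Finset.mul_sum]
    refine Finset.sum_congr rfl fun j _ => ?_
    by_cases h : l j = r j
    · have : ∀ δ : α → Bool, ¬ (δ (r j) = true ∧ δ (r j) = false) := fun δ => by simp
      simp [h, this]
    · rw [if_pos h, ← mul_assoc, sum_ite_true_false h]
  have hD : (0 : ℝ) < Fintype.card (α → Bool) := by exact_mod_cast Fintype.card_pos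
  refine le_of_mul_le_mul_left ?_ hD
  calc _ = ∑ f : α → β, Fintype.card ((α → Bool) × (α → β)) *
        |∑ j ∈ s with l j ≠ r j, G j (f (l j)) (f (r j))| ^ p := by
        rw [← mul_assoc, ← Nat.cast_mul, ← Fintype.card_prod, Finset.mul_sum]
    _ ≤ ∑ f : α → β, 4 ^ p * ∑ q : (α → Bool) × (α → β),
        |Ψ (blend q.1 f q.2) (blend q.1 q.2 f)| ^ p := Finset.sum_le_sum fun f _ => key f
    _ = 4 ^ p * ∑ δ : α → Bool, ∑ f : α → β, ∑ g : α → β,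
        |Ψ (blend δ f g) (blend δ g f)| ^ p := by
        rw [← Finset.mul_sum, Finset.sum_comm, Fintype.sum_prod_type]
        congr 1
        exact Finset.sum_congr rfl fun δ _ => Finset.sum_comm
    _ = 4 ^ p * ∑ δ : α → Bool, ∑ f : α → β, ∑ g : α → β, |Ψ f g| ^ p := by
        congr 1
        refine Finset.sum_congr rfl fun δ _ => ?_
        -- For fixed `δ`, the two blends exchange the entries of `f` and `g` where `δ` is false, so
        -- they are again independent and uniform.
        refine sum_sum_resample (fun f g : α → β => blend δ f g) (fun f g => blend δ g f) ?_ ?_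
          (fun f g => |Ψ f g| ^ p) <;>
        · intro f g
          ext a
          by_cases h : δ a <;> simp [blend, h]
    _ = _ := by simp; ring

/-! ### Signs, and exchanging or replacing blocks of table entries. -/

theorem sum_eq_zero_of_neg {X : Type*} [Fintype X] (e : X ≃ X) (G : X → ℝ)
    (h : ∀ x, G (e x) = -G x) : ∑ x, G x = 0 := by
  have h1 := Equiv.sum_comp e G
  simp only [h, Finset.sum_neg_distrib] at h1
  linarith

noncomputable instance instFintypeMixedTables (b r c d : ℕ) : Fintype (MixedTables b r c d) :=
  Fintype.ofFinite _

theorem sgn_neg (e : ℤˣ) : sgn (-e) = -sgn e := by simp [sgn]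

theorem sgn_mul (e e' : ℤˣ) : sgn (e * e') = sgn e * sgn e' := by simp [sgn]

theorem sgn_mul_self (e : ℤˣ) : sgn e * sgn e = 1 := by
  rcases Int.units_eq_one_or e with rfl | rfl <;> simp [sgn]

theorem abs_sgn (e : ℤˣ) : |sgn e| = 1 := by
  rcases Int.units_eq_one_or e with rfl | rfl <;> simp [sgn]

theorem prod_eq_neg_prod {ι : Type*} [Fintype ι] [DecidableEq ι] (k : ι) {f g : ι → ℤˣ}
    (h : ∀ j, f j = if j = k then -g j else g j) : ∏ j, f j = -∏ j, g j := by
  rw [← Finset.mul_prod_erase _ f (Finset.mem_univ k),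
    ← Finset.mul_prod_erase _ g (Finset.mem_univ k), h k, if_pos rfl, neg_mul]
  congr 2
  exact Finset.prod_congr rfl fun j hj => by rw [h j, if_neg (Finset.ne_of_mem_erase hj)]

namespace MixedTables

variable {b r c d d' s : ℕ}

/-- The tables `T`, with the tables `h₁`, `σ₁`, and `h₂` for the derived character `t`, at the
positions in `J`, and the tables `h₃`, `σ₃` of the derived character `t`, taken from the derived
character `t'` of `F`. -/
def mix (J : Finset (Fin c)) (t : Fin d) (t' : Fin d') (T : MixedTables b r c d)
    (F : MixedTables b r c d') : MixedTables b r c d where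
  h1 k α := if k ∈ J then F.h1 k α else T.h1 k α
  s1 k α := if k ∈ J then F.s1 k α else T.s1 k α
  h2 k α j := if k ∈ J ∧ j = t then F.h2 k α t' else T.h2 k α j
  h3 j z := if j = t then F.h3 t' z else T.h3 j z
  s3 j z := if j = t then F.s3 t' z else T.s3 j z

/-- Both mixes exchange the same block, so doing it twice restores the tables. Allowing `d' ≠ d`
lets the fresh block come from tables with a single derived character. -/
theorem mix_mix (J : Finset (Fin c)) (t : Fin d) (t' : Fin d') (T : MixedTables b r c d)
    (F : MixedTables b r c d') : mix J t t' (mix J t t' T F) (mix J t' t F T) = T := by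
  cases T
  simp only [mix, MixedTables.mk.injEq]
  refine ⟨?_, ?_, ?_, ?_, ?_⟩ <;> ext <;> split_ifs <;> simp_all

theorem mix_self (J : Finset (Fin c)) (t : Fin d) (T : MixedTables b r c d) :
    mix J t t T T = T := by
  cases T
  simp only [mix, MixedTables.mk.injEq]
  refine ⟨?_, ?_, ?_, ?_, ?_⟩ <;> ext <;> split_ifs <;> simp_all

/-- The tables `T`, with the tables for the character `k` and the derived character `t` replaced
by `f`. -/
def setChar (k : Fin c) (t : Fin d) (T : MixedTables b r c d)
    (f : Bits b → Bits r × ℤˣ × Bits b) : MixedTables b r c d where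
  h1 k' α := if k' = k then (f α).1 else T.h1 k' α
  s1 k' α := if k' = k then (f α).2.1 else T.s1 k' α
  h2 k' α j := if k' = k ∧ j = t then (f α).2.2 else T.h2 k' α j
  h3 := T.h3
  s3 := T.s3

/-- The tables that `setChar` replaces. -/
def getChar (k : Fin c) (t : Fin d) (T : MixedTables b r c d) :
    Bits b → Bits r × ℤˣ × Bits b := fun α => (T.h1 k α, T.s1 k α, T.h2 k α t)

theorem setChar_setChar (k : Fin c) (t : Fin d) (T : MixedTables b r c d)
    (f : Bits b → Bits r × ℤˣ × Bits b) : setChar k t (setChar k t T f) (getChar k t T) = T := by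
  cases T
  simp only [setChar, getChar, MixedTables.mk.injEq]
  refine ⟨?_, ?_, ?_, trivial, trivial⟩ <;> ext <;> split_ifs <;> simp_all

theorem getChar_setChar (k : Fin c) (t : Fin d) (T : MixedTables b r c d)
    (f : Bits b → Bits r × ℤˣ × Bits b) : getChar k t (setChar k t T f) = f := by
  ext α <;> simp [setChar, getChar]

/-- The tables `T`, with the tables `h₃`, `σ₃` of the derived character `t` replaced by `f`. -/
def setDer (t : Fin d) (T : MixedTables b r c d) (f : Bits b → Bits r × ℤˣ) :
    MixedTables b r c d where
  h1 := T.h1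
  s1 := T.s1
  h2 := T.h2
  h3 j z := if j = t then (f z).1 else T.h3 j z
  s3 j z := if j = t then (f z).2 else T.s3 j z

/-- The tables that `setDer` replaces. -/
def getDer (t : Fin d) (T : MixedTables b r c d) : Bits b → Bits r × ℤˣ :=
  fun z => (T.h3 t z, T.s3 t z)

theorem setDer_setDer (t : Fin d) (T : MixedTables b r c d) (f : Bits b → Bits r × ℤˣ) :
    setDer t (setDer t T f) (getDer t T) = T := by
  cases T
  simp only [setDer, getDer, MixedTables.mk.injEq]
  refine ⟨trivial, trivial, trivial, ?_, ?_⟩ <;> ext <;> split_ifs <;> simp_all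

theorem getDer_setDer (t : Fin d) (T : MixedTables b r c d) (f : Bits b → Bits r × ℤˣ) :
    getDer t (setDer t T f) = f := by
  ext α <;> simp [setDer, getDer]

/-- With `mix_insert_setChar`: for `k ∉ A`, passing from `A` to `insert k A` only changes which of
the two independent blocks `f`, `g` is read at position `k`. -/
theorem mix_setChar_of_notMem {A : Finset (Fin c)} {k : Fin c} (hk : k ∉ A) (t : Fin d)
    (T F : MixedTables b r c d) (f g : Bits b → Bits r × ℤˣ × Bits b) :
    mix A t t (setChar k t T f) (setChar k t F g) = setChar k t (mix A t t T F) f := by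
  have h' : ∀ k', k' ∈ A → k' ≠ k := fun k' h e => hk (e ▸ h)
  simp only [setChar, mix, MixedTables.mk.injEq]
  refine ⟨?_, ?_, ?_, trivial, trivial⟩ <;> ext k' <;> by_cases h1 : k' ∈ A <;>
    by_cases h2 : k' = k <;> simp_all

theorem mix_insert_setChar (A : Finset (Fin c)) (k : Fin c) (t : Fin d)
    (T F : MixedTables b r c d) (f g : Bits b → Bits r × ℤˣ × Bits b) :
    mix (insert k A) t t (setChar k t T f) (setChar k t F g) = setChar k t (mix A t t T F) g := by
  simp only [setChar, mix, MixedTables.mk.injEq, Finset.mem_insert]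
  refine ⟨?_, ?_, ?_, trivial, trivial⟩
  · ext k'; by_cases h2 : k' = k <;> simp_all
  · ext k'; by_cases h2 : k' = k <;> simp_all
  · ext k' α j; by_cases h2 : k' = k <;> by_cases h3 : j = t <;> simp_all

theorem mix_empty_setDer (t : Fin d) (T F : MixedTables b r c d) (f g : Bits b → Bits r × ℤˣ) :
    mix ∅ t t (setDer t T f) (setDer t F g) = setDer t T g := by
  simp only [setDer, mix, MixedTables.mk.injEq]
  refine ⟨?_, ?_, ?_, ?_, ?_⟩ <;> ext <;> split_ifs <;> simp_all

theorem hash1_mix (J : Finset (Fin c)) (t : Fin d) (t' : Fin d') (T : MixedTables b r c d)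
    (F : MixedTables b r c d') (x : Key b c) :
    (mix J t t' T F).hash1 .univ x = F.hash1 J x + T.hash1 Jᶜ x := by
  rw [hash1, ← Finset.sum_add_sum_compl J]
  congr 1 <;> refine Finset.sum_congr rfl fun k hk => ?_ <;> simp_all [mix]

theorem sign1_mix (J : Finset (Fin c)) (t : Fin d) (t' : Fin d') (T : MixedTables b r c d)
    (F : MixedTables b r c d') (x : Key b c) :
    (mix J t t' T F).sign1 .univ x = F.sign1 J x * T.sign1 Jᶜ x := by
  rw [sign1, ← Finset.prod_mul_prod_compl J]
  congr 1 <;> refine Finset.prod_congr rfl fun k hk => ?_ <;> simp_all [mix]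

theorem hash2_apply (T : MixedTables b r c d) (I : Finset (Fin c)) (x : Key b c) (j : Fin d) :
    T.hash2 I x j = ∑ k ∈ I, T.h2 k (x k) j := by
  simp [hash2]

theorem hash2_mix_self (J : Finset (Fin c)) (t : Fin d) (t' : Fin d') (T : MixedTables b r c d)
    (F : MixedTables b r c d') (x : Key b c) :
    (mix J t t' T F).hash2 .univ x t = F.hash2 J x t' + T.hash2 Jᶜ x t := by
  simp only [hash2_apply]
  rw [← Finset.sum_add_sum_compl J]
  congr 1 <;> refine Finset.sum_congr rfl fun k hk => ?_ <;> simp_all [mix]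

theorem hash2_mix_of_ne (J : Finset (Fin c)) (t : Fin d) (t' : Fin d') (T : MixedTables b r c d)
    (F : MixedTables b r c d') (x : Key b c) {j : Fin d} (hj : j ≠ t) :
    (mix J t t' T F).hash2 .univ x j = T.hash2 .univ x j := by
  simp only [hash2_apply]
  refine Finset.sum_congr rfl fun k hk => ?_
  simp_all [mix]

theorem hash_mix (J : Finset (Fin c)) (t : Fin d) (t' : Fin d') (T : MixedTables b r c d)
    (F : MixedTables b r c d') (i : Fin s) (x : Key b c) :
    (mix J t t' T F).hash i x =
      (F.hash1 J x + F.h3 t' (F.hash2 J x t' + bitsOf b i + T.hash2 Jᶜ x t)) +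
      (T.hash1 Jᶜ x + T.hash3 {t}ᶜ (fun k => T.hash2 .univ x k + bitsOf b i)) := by
  rw [hash, hash1_mix, hash3, ← Finset.sum_add_sum_compl {t}, Finset.sum_singleton,
    hash2_mix_self, hash3, add_add_add_comm]
  congr 2
  · simp only [mix, if_true]
    rw [add_right_comm]
  · refine Finset.sum_congr rfl fun k hk => ?_
    have hk' : k ≠ t := by simpa using hk
    rw [hash2_mix_of_ne _ _ _ _ _ _ hk']
    simp [mix, hk']

theorem sign_mix (J : Finset (Fin c)) (t : Fin d) (t' : Fin d') (T : MixedTables b r c d)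
    (F : MixedTables b r c d') (i : Fin s) (x : Key b c) :
    (mix J t t' T F).sign i x =
      (F.sign1 J x * F.s3 t' (F.hash2 J x t' + bitsOf b i + T.hash2 Jᶜ x t)) *
      (T.sign1 Jᶜ x * T.sign3 {t}ᶜ (fun k => T.hash2 .univ x k + bitsOf b i)) := by
  rw [sign, sign1_mix, sign3, ← Finset.prod_mul_prod_compl {t}, Finset.prod_singleton,
    hash2_mix_self, sign3, mul_mul_mul_comm]
  congr 2
  · simp only [mix, if_true]
    rw [add_right_comm]
  · refine Finset.prod_congr rfl fun k hk => ?_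
    have hk' : k ≠ t := by simpa using hk
    rw [hash2_mix_of_ne _ _ _ _ _ _ hk']
    simp [mix, hk']

/-- Turns the decoupled functions into ordinary Mixed Tabulation with exchanged entries, so that
only `hash` and `sign` have to be analysed from here on. -/
theorem decHash_eq_hash_mix (J : Finset (Fin c)) (t : Fin d) (T F : MixedTables b r c d) :
    (T.decHash F J t : Fin s → Key b c → Bits r) = (mix J t t T F).hash := by
  ext1 i; ext1 x
  rw [hash_mix, decHash, hash3, Finset.sum_singleton]

theorem decSign_eq_sign_mix (J : Finset (Fin c)) (t : Fin d) (T F : MixedTables b r c d) :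
    (T.decSign F J t : Fin s → Key b c → ℤˣ) = (mix J t t T F).sign := by
  ext1 i; ext1 x
  rw [sign_mix, decSign, sign3, Finset.prod_singleton]

/-- A key reads the table at position `k` only at its own character; a constant table records that
single entry. -/
theorem hash_setChar (k : Fin c) (t : Fin d) (T : MixedTables b r c d)
    (f : Bits b → Bits r × ℤˣ × Bits b) (i : Fin s) (x : Key b c) :
    (setChar k t T f).hash i x = (setChar k t T fun _ => f (x k)).hash i x := by
  have h1 : (setChar k t T f).hash1 .univ x = (setChar k t T fun _ => f (x k)).hash1 .univ x :=
    Finset.sum_congr rfl fun k' _ => by by_cases h : k' = k <;> simp [setChar, h]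
  have h2 : (setChar k t T f).hash2 .univ x = (setChar k t T fun _ => f (x k)).hash2 .univ x :=
    Finset.sum_congr rfl fun k' _ => by ext1 j; by_cases h : k' = k <;> simp [setChar, h]
  rw [hash, hash, h1, h2]
  rfl

theorem sign_setChar (k : Fin c) (t : Fin d) (T : MixedTables b r c d)
    (f : Bits b → Bits r × ℤˣ × Bits b) (i : Fin s) (x : Key b c) :
    (setChar k t T f).sign i x = (setChar k t T fun _ => f (x k)).sign i x := by
  have h1 : (setChar k t T f).sign1 .univ x = (setChar k t T fun _ => f (x k)).sign1 .univ x :=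
    Finset.prod_congr rfl fun k' _ => by by_cases h : k' = k <;> simp [setChar, h]
  have h2 : (setChar k t T f).hash2 .univ x = (setChar k t T fun _ => f (x k)).hash2 .univ x :=
    Finset.sum_congr rfl fun k' _ => by ext1 j; by_cases h : k' = k <;> simp [setChar, h]
  rw [sign, sign, h1, h2]
  rfl

theorem sign_setChar_neg (k : Fin c) (t : Fin d) (T : MixedTables b r c d) (a : Bits r) (e : ℤˣ)
    (u : Bits b) (i : Fin s) (x : Key b c) :
    (setChar k t T fun _ => (a, -e, u)).sign i x =
      -(setChar k t T fun _ => (a, e, u)).sign i x := by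
  have h1 : (setChar k t T fun _ => (a, -e, u)).sign1 .univ x =
      -(setChar k t T fun _ => (a, e, u)).sign1 .univ x := by
    exact prod_eq_neg_prod k fun k' => by by_cases h : k' = k <;> simp [setChar, h]
  rw [sign, h1, neg_mul]
  rfl

theorem hash_setDer (t : Fin d) (T : MixedTables b r c d) (f : Bits b → Bits r × ℤˣ) (i : Fin s)
    (x : Key b c) : (setDer t T f).hash i x =
      (setDer t T fun _ => f (T.hash2 .univ x t + bitsOf b i)).hash i x := by
  rw [hash, hash]
  congr 1
  exact Finset.sum_congr rfl fun j _ => by by_cases h : j = t <;> simp [setDer, h, hash2]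

theorem sign_setDer (t : Fin d) (T : MixedTables b r c d) (f : Bits b → Bits r × ℤˣ) (i : Fin s)
    (x : Key b c) : (setDer t T f).sign i x =
      (setDer t T fun _ => f (T.hash2 .univ x t + bitsOf b i)).sign i x := by
  rw [sign, sign]
  congr 1
  exact Finset.prod_congr rfl fun j _ => by by_cases h : j = t <;> simp [setDer, h, hash2]

theorem sign_setDer_neg (t : Fin d) (T : MixedTables b r c d) (a : Bits r) (e : ℤˣ) (i : Fin s)
    (x : Key b c) :
    (setDer t T fun _ => (a, -e)).sign i x = -(setDer t T fun _ => (a, e)).sign i x := by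
  rw [sign, sign, ← mul_neg]
  congr 1
  exact prod_eq_neg_prod t fun j => by by_cases h : j = t <;> simp [setDer, h, hash2]

end MixedTables

/-! ### Decoupling of the Mixed Tabulation sums, table by table. -/

variable {b r c d : ℕ}

/-- The term of `decoupledSum` for the hash functions `T` and `T'` at `j = (i, x, y)`. -/
noncomputable def quadTerm {s : ℕ} (T T' : MixedTables b r c d) (w : Key b c → ℝ)
    (j : Fin s × Key b c × Key b c) : ℝ :=
  sgn (T.sign j.1 j.2.1) * sgn (T'.sign j.1 j.2.2) *
    (if T.hash j.1 j.2.1 = T'.hash j.1 j.2.2 then 1 else 0) * w j.2.1 * w j.2.2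

open Classical in
/-- The part of `decoupledSum` given by the pairs of keys in `U` that satisfy `Q`. -/
noncomputable def quadSum (s : ℕ) (U : Finset (Key b c)) (Q : Key b c → Key b c → Prop)
    (T T' : MixedTables b r c d) (w : Key b c → ℝ) : ℝ :=
  ∑ j : Fin s × Key b c × Key b c with j.2.1 ∈ U ∧ j.2.2 ∈ U ∧ Q j.2.1 j.2.2, quadTerm T T' w j

theorem decoupledSum_eq_quadSum (s : ℕ) (U : Finset (Key b c)) (T T' : MixedTables b r c d)
    (w : Key b c → ℝ) :
    decoupledSum (s := s) U T.hash T.sign T'.hash T'.sign w =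
      quadSum s U (fun _ _ => True) T T' w := by
  classical
  have : (Finset.univ.filter fun j : Fin s × Key b c × Key b c =>
      j.2.1 ∈ U ∧ j.2.2 ∈ U ∧ True) = Finset.univ ×ˢ U ×ˢ U := by
    ext j; simp
  simp only [quadSum, this, Finset.sum_product, decoupledSum, quadTerm]

theorem sum_quadTerm_setChar_left (k : Fin c) (t : Fin d) (T T' : MixedTables b r c d)
    (w : Key b c → ℝ) {s : ℕ} (j : Fin s × Key b c × Key b c) :
    ∑ v, quadTerm (setChar k t T fun _ => v) T' w j = 0 := by
  -- Negating only the sign component leaves `h₁` and `h₂`, hence the collision indicator,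
  -- unchanged.
  refine sum_eq_zero_of_neg ((Equiv.refl _).prodCongr ((Equiv.neg ℤˣ).prodCongr (Equiv.refl _)))
    _ fun v => ?_
  obtain ⟨a, e, u⟩ := v
  have hh : ∀ x : Key b c, (setChar k t T fun _ => (a, -e, u)).hash j.1 x =
    (setChar k t T fun _ => (a, e, u)).hash j.1 x := fun x => rfl
  simp only [Equiv.prodCongr_apply, Equiv.refl_apply, Prod.map, Equiv.neg_apply, quadTerm,
    sign_setChar_neg, sgn_neg, hh]
  ring

theorem sum_quadTerm_setChar_right (k : Fin c) (t : Fin d) (T T' : MixedTables b r c d)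
    (w : Key b c → ℝ) {s : ℕ} (j : Fin s × Key b c × Key b c) :
    ∑ v, quadTerm T (setChar k t T' fun _ => v) w j = 0 := by
  refine sum_eq_zero_of_neg ((Equiv.refl _).prodCongr ((Equiv.neg ℤˣ).prodCongr (Equiv.refl _)))
    _ fun v => ?_
  obtain ⟨a, e, u⟩ := v
  have hh : ∀ x : Key b c, (setChar k t T' fun _ => (a, -e, u)).hash j.1 x =
    (setChar k t T' fun _ => (a, e, u)).hash j.1 x := fun x => rfl
  simp only [Equiv.prodCongr_apply, Equiv.refl_apply, Prod.map, Equiv.neg_apply, quadTerm,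
    sign_setChar_neg, sgn_neg, hh]
  ring

theorem sum_quadTerm_setDer_left (t : Fin d) (T T' : MixedTables b r c d)
    (w : Key b c → ℝ) {s : ℕ} (j : Fin s × Key b c × Key b c) :
    ∑ v, quadTerm (setDer t T fun _ => v) T' w j = 0 := by
  refine sum_eq_zero_of_neg ((Equiv.refl _).prodCongr (Equiv.neg ℤˣ)) _ fun v => ?_
  obtain ⟨a, e⟩ := v
  have hh : ∀ x : Key b c, (setDer t T fun _ => (a, -e)).hash j.1 x =
    (setDer t T fun _ => (a, e)).hash j.1 x := fun x => rfl
  simp only [Equiv.prodCongr_apply, Equiv.refl_apply, Prod.map, Equiv.neg_apply, quadTerm,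
    sign_setDer_neg, sgn_neg, hh]
  ring

theorem sum_quadTerm_setDer_right (t : Fin d) (T T' : MixedTables b r c d)
    (w : Key b c → ℝ) {s : ℕ} (j : Fin s × Key b c × Key b c) :
    ∑ v, quadTerm T (setDer t T' fun _ => v) w j = 0 := by
  refine sum_eq_zero_of_neg ((Equiv.refl _).prodCongr (Equiv.neg ℤˣ)) _ fun v => ?_
  obtain ⟨a, e⟩ := v
  have hh : ∀ x : Key b c, (setDer t T' fun _ => (a, -e)).hash j.1 x =
    (setDer t T' fun _ => (a, e)).hash j.1 x := fun x => rfl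
  simp only [Equiv.prodCongr_apply, Equiv.refl_apply, Prod.map, Equiv.neg_apply, quadTerm,
    sign_setDer_neg, sgn_neg, hh]
  ring

theorem quadTerm_setChar (k : Fin c) (t : Fin d) (T T' : MixedTables b r c d)
    (f g : Bits b → Bits r × ℤˣ × Bits b) (w : Key b c → ℝ) {s : ℕ}
    (j : Fin s × Key b c × Key b c) :
    quadTerm (setChar k t T f) (setChar k t T' g) w j =
      quadTerm (setChar k t T fun _ => f (j.2.1 k)) (setChar k t T' fun _ => g (j.2.2 k)) w j := by
  rw [quadTerm, quadTerm, hash_setChar k t T, hash_setChar k t T', sign_setChar k t T,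
    sign_setChar k t T']

theorem quadTerm_setDer (t : Fin d) (T T' : MixedTables b r c d)
    (f g : Bits b → Bits r × ℤˣ) (w : Key b c → ℝ) {s : ℕ} (j : Fin s × Key b c × Key b c) :
    quadTerm (setDer t T f) (setDer t T' g) w j =
      quadTerm (setDer t T fun _ => f (T.hash2 .univ j.2.1 t + bitsOf b j.1))
        (setDer t T' fun _ => g (T'.hash2 .univ j.2.2 t + bitsOf b j.1)) w j := by
  rw [quadTerm, quadTerm, hash_setDer t T, hash_setDer t T', sign_setDer t T, sign_setDer t T']

theorem sum_setChar_quadSum_le {p : ℝ} (hp : 1 ≤ p) {s : ℕ} (k : Fin c) (t : Fin d)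
    (U : Finset (Key b c)) (Q : Key b c → Key b c → Prop) (T T' : MixedTables b r c d)
    (w : Key b c → ℝ) :
    Fintype.card (Bits b → Bits r × ℤˣ × Bits b) * ∑ f : Bits b → Bits r × ℤˣ × Bits b,
        |quadSum s U (fun x y => Q x y ∧ x k ≠ y k) (setChar k t T f) (setChar k t T' f) w| ^ p ≤
      4 ^ p * ∑ f : Bits b → Bits r × ℤˣ × Bits b, ∑ g : Bits b → Bits r × ℤˣ × Bits b,
        |quadSum s U Q (setChar k t T f) (setChar k t T' g) w| ^ p := by
  classical
  have h := sum_abs_rpow_decouple hp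
    (Finset.univ.filter fun j : Fin s × Key b c × Key b c => j.2.1 ∈ U ∧ j.2.2 ∈ U ∧ Q j.2.1 j.2.2)
    (fun j => j.2.1 k) (fun j => j.2.2 k)
    (fun j v v' => quadTerm (setChar k t T fun _ => v) (setChar k t T' fun _ => v') w j)
    (fun j v' => sum_quadTerm_setChar_left k t T _ w j)
    (fun j v => sum_quadTerm_setChar_right k t _ T' w j)
  simp only [← quadTerm_setChar, Finset.filter_filter, and_assoc] at h
  simp only [quadSum]
  convert h

theorem sum_setDer_quadSum_le {p : ℝ} (hp : 1 ≤ p) {s : ℕ} (t : Fin d)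
    (U : Finset (Key b c)) (Q : Key b c → Key b c → Prop) (T : MixedTables b r c d)
    (w : Key b c → ℝ) :
    Fintype.card (Bits b → Bits r × ℤˣ) * ∑ f : Bits b → Bits r × ℤˣ,
        |quadSum s U (fun x y => Q x y ∧ T.hash2 .univ x t ≠ T.hash2 .univ y t)
          (setDer t T f) (setDer t T f) w| ^ p ≤
      4 ^ p * ∑ f : Bits b → Bits r × ℤˣ, ∑ g : Bits b → Bits r × ℤˣ,
        |quadSum s U Q (setDer t T f) (setDer t T g) w| ^ p := by
  classical
  have h := sum_abs_rpow_decouple hp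
    (Finset.univ.filter fun j : Fin s × Key b c × Key b c => j.2.1 ∈ U ∧ j.2.2 ∈ U ∧ Q j.2.1 j.2.2)
    (fun j => T.hash2 .univ j.2.1 t + bitsOf b j.1) (fun j => T.hash2 .univ j.2.2 t + bitsOf b j.1)
    (fun j v v' => quadTerm (setDer t T fun _ => v) (setDer t T fun _ => v') w j)
    (fun j v' => sum_quadTerm_setDer_left t T _ w j)
    (fun j v => sum_quadTerm_setDer_right t _ T w j)
  -- Both keys are shifted by the same `i`, so they read different entries exactly when their
  -- derived characters at `t` differ.
  simp only [← quadTerm_setDer, Finset.filter_filter, and_assoc, ne_eq, add_left_inj] at h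
  simp only [quadSum]
  convert h

theorem sum_sum_setChar {M : Type*} [AddCommMonoid M] (k : Fin c) (t : Fin d)
    (G : MixedTables b r c d → M) :
    ∑ T, ∑ f, G (setChar k t T f) =
      Fintype.card (Bits b → Bits r × ℤˣ × Bits b) • ∑ T, G T := by
  have h := sum_sum_resample (fun (T : MixedTables b r c d) f => setChar k t T f)
    (fun T _ => getChar k t T) (fun T f => setChar_setChar k t T f)
    (fun T f => getChar_setChar k t T f) (fun T _ => G T)
  rw [h]
  simp only [Finset.sum_const, Finset.card_univ, Finset.smul_sum]

theorem sum_sum_setDer {M : Type*} [AddCommMonoid M] (t : Fin d)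
    (G : MixedTables b r c d → M) :
    ∑ T, ∑ f, G (setDer t T f) = Fintype.card (Bits b → Bits r × ℤˣ) • ∑ T, G T := by
  have h := sum_sum_resample (fun (T : MixedTables b r c d) f => setDer t T f)
    (fun T _ => getDer t T) (fun T f => setDer_setDer t T f)
    (fun T f => getDer_setDer t T f) (fun T _ => G T)
  rw [h]
  simp only [Finset.sum_const, Finset.card_univ, Finset.smul_sum]

/-- Decoupling of the tables of the character `k`. -/
theorem sum_quadSum_mix_insert_le {p : ℝ} (hp : 1 ≤ p) {s : ℕ} {A : Finset (Fin c)} {k : Fin c}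
    (hk : k ∉ A) (t : Fin d) (U : MixedTables b r c d → Finset (Key b c))
    (hU : ∀ T f, U (setChar k t T f) = U T) (Q : Key b c → Key b c → Prop) (w : Key b c → ℝ) :
    ∑ T, ∑ F, |quadSum s (U T) (fun x y => Q x y ∧ x k ≠ y k) T (mix A t t T F) w| ^ p ≤
      4 ^ p * ∑ T, ∑ F, |quadSum s (U T) Q T (mix (insert k A) t t T F) w| ^ p := by
  set N : ℝ := ((Fintype.card (Bits b → Bits r × ℤˣ × Bits b) : ℕ) : ℝ) with hN
  have hN0 : 0 < N := by rw [hN]; exact_mod_cast Fintype.card_pos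
  -- Resampling the block at `k` in both tables multiplies the sum by `N ^ 2`; after that the
  -- inequality holds for each fixed `T` and `F`.
  have e : ∀ G : MixedTables b r c d → MixedTables b r c d → ℝ,
      ∑ T, ∑ F, ∑ f, ∑ g, G (setChar k t T f) (setChar k t F g) = N * (N * ∑ T, ∑ F, G T F) := by
    intro G
    calc _ = ∑ T, ∑ f, ∑ F, ∑ g, G (setChar k t T f) (setChar k t F g) :=
          Finset.sum_congr rfl fun T _ => Finset.sum_comm
      _ = ∑ T, ∑ f, N * ∑ F, G (setChar k t T f) F := by
          simp only [sum_sum_setChar k t (G _), nsmul_eq_mul, hN]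
      _ = N * ∑ T, N * ∑ F, G T F := by
          rw [sum_sum_setChar k t fun T => N * ∑ F, G T F, nsmul_eq_mul]
      _ = _ := by simp only [← Finset.mul_sum]
  refine le_of_mul_le_mul_left (le_of_mul_le_mul_left ?_ hN0) hN0
  rw [← e fun T F => |quadSum s (U T) (fun x y => Q x y ∧ x k ≠ y k) T (mix A t t T F) w| ^ p,
    mul_left_comm N (4 ^ p), mul_left_comm N (4 ^ p),
    ← e fun T F => |quadSum s (U T) Q T (mix (insert k A) t t T F) w| ^ p, Finset.mul_sum]
  refine Finset.sum_le_sum fun T _ => ?_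
  rw [Finset.mul_sum]
  refine Finset.sum_le_sum fun F _ => ?_
  simp only [hU, mix_setChar_of_notMem hk, mix_insert_setChar]
  refine le_trans (le_of_eq ?_) (sum_setChar_quadSum_le hp k t (U T) Q T (mix A t t T F) w)
  simp only [Finset.sum_const, Finset.card_univ, nsmul_eq_mul, Finset.mul_sum]

/-- Decoupling of the tables of the derived character `t`. -/
theorem sum_quadSum_self_le {p : ℝ} (hp : 1 ≤ p) {s : ℕ} (t : Fin d)
    (U : MixedTables b r c d → Finset (Key b c))
    (hU : ∀ T f, U (setDer t T f) = U T) (Q : Key b c → Key b c → Prop) (w : Key b c → ℝ) :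
    Fintype.card (MixedTables b r c d) * ∑ T : MixedTables b r c d,
        |quadSum s (U T) (fun x y => Q x y ∧ T.hash2 .univ x t ≠ T.hash2 .univ y t) T T w| ^ p ≤
      4 ^ p * ∑ T, ∑ F, |quadSum s (U T) Q T (mix ∅ t t T F) w| ^ p := by
  set N : ℝ := ((Fintype.card (Bits b → Bits r × ℤˣ) : ℕ) : ℝ) with hN
  have hN0 : 0 < N := by rw [hN]; exact_mod_cast Fintype.card_pos
  have e : ∀ G : MixedTables b r c d → MixedTables b r c d → ℝ,
      ∑ T, ∑ F, ∑ f, ∑ g, G (setDer t T f) (setDer t F g) = N * (N * ∑ T, ∑ F, G T F) := by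
    intro G
    calc _ = ∑ T, ∑ f, ∑ F, ∑ g, G (setDer t T f) (setDer t F g) :=
          Finset.sum_congr rfl fun T _ => Finset.sum_comm
      _ = ∑ T, ∑ f, N * ∑ F, G (setDer t T f) F := by
          simp only [sum_sum_setDer t (G _), nsmul_eq_mul, hN]
      _ = N * ∑ T, N * ∑ F, G T F := by
          rw [sum_sum_setDer t fun T => N * ∑ F, G T F, nsmul_eq_mul]
      _ = _ := by simp only [← Finset.mul_sum]
  have e0 : Fintype.card (MixedTables b r c d) * ∑ T : MixedTables b r c d,
      |quadSum s (U T) (fun x y => Q x y ∧ T.hash2 .univ x t ≠ T.hash2 .univ y t) T T w| ^ p =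
      ∑ T : MixedTables b r c d, ∑ _F : MixedTables b r c d,
      |quadSum s (U T) (fun x y => Q x y ∧ T.hash2 .univ x t ≠ T.hash2 .univ y t) T T w| ^ p := by
    simp only [Finset.sum_const, Finset.card_univ, nsmul_eq_mul, Finset.mul_sum]
  refine le_of_mul_le_mul_left (le_of_mul_le_mul_left ?_ hN0) hN0
  rw [e0, ← e fun T _ => |quadSum s (U T)
      (fun x y => Q x y ∧ T.hash2 .univ x t ≠ T.hash2 .univ y t) T T w| ^ p,
    mul_left_comm N (4 ^ p), mul_left_comm N (4 ^ p),
    ← e fun T F => |quadSum s (U T) Q T (mix ∅ t t T F) w| ^ p, Finset.mul_sum]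
  refine Finset.sum_le_sum fun T _ => ?_
  rw [Finset.mul_sum]
  refine Finset.sum_le_sum fun F _ => ?_
  simp only [hU, mix_empty_setDer]
  refine le_trans (le_of_eq ?_) (sum_setDer_quadSum_le hp t (U T) Q T w)
  have h2 : ∀ (f : Bits b → Bits r × ℤˣ) (x : Key b c),
    (setDer t T f).hash2 .univ x = T.hash2 .univ x := fun f x => rfl
  simp only [Finset.sum_const, Finset.card_univ, nsmul_eq_mul, Finset.mul_sum, h2]

theorem sum_quadSum_mix_le {p : ℝ} (hp : 1 ≤ p) {s : ℕ} (A : Finset (Fin c)) (t : Fin d)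
    (U : MixedTables b r c d → Finset (Key b c)) (hU : ∀ k T f, U (setChar k t T f) = U T)
    (Q : Key b c → Key b c → Prop) (w : Key b c → ℝ) :
    ∑ T, ∑ F, |quadSum s (U T) (fun x y => Q x y ∧ ∀ k ∈ A, x k ≠ y k) T (mix ∅ t t T F) w| ^ p ≤
      (4 ^ p) ^ A.card * ∑ T, ∑ F, |quadSum s (U T) Q T (mix A t t T F) w| ^ p := by
  induction A using Finset.induction_on generalizing Q with
  | empty => simp
  | insert k A hk ih =>
    calc _ = ∑ T, ∑ F, |quadSum s (U T) (fun x y => (Q x y ∧ x k ≠ y k) ∧ ∀ k ∈ A, x k ≠ y k) T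
          (mix ∅ t t T F) w| ^ p := by
          simp only [Finset.forall_mem_insert, and_assoc]
      _ ≤ (4 ^ p) ^ A.card * ∑ T, ∑ F,
          |quadSum s (U T) (fun x y => Q x y ∧ x k ≠ y k) T (mix A t t T F) w| ^ p := ih _
      _ ≤ (4 ^ p) ^ A.card * (4 ^ p * ∑ T, ∑ F,
          |quadSum s (U T) Q T (mix (insert k A) t t T F) w| ^ p) := by
          gcongr
          exact sum_quadSum_mix_insert_le hp hk t U (hU k) Q w
      _ = _ := by rw [Finset.card_insert_of_notMem hk, pow_succ, mul_assoc]

theorem hash2_setChar_of_ne (k : Fin c) {t j : Fin d} (hj : j ≠ t) (T : MixedTables b r c d)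
    (f : Bits b → Bits r × ℤˣ × Bits b) (x : Key b c) :
    (setChar k t T f).hash2 .univ x j = T.hash2 .univ x j := by
  simp only [hash2_apply]
  exact Finset.sum_congr rfl fun k' _ => by simp [setChar, hj]

theorem mem_keySet {π : PartialKey b c} {τ : Prefix b d} {T : MixedTables b r c d} {x : Key b c} :
    x ∈ keySet π τ T ↔ π.Sub x ∧ τ.Sub (T.hash2 .univ x) := by
  simp [keySet]

/-- The prefix `τ` constrains only the coordinates before `τ.1`, so `U_{π,τ}` stays fixed while
coordinate `τ.1` of `h₂` is resampled. -/
theorem keySet_congr (π : PartialKey b c) (τ : Prefix b d) {T T' : MixedTables b r c d}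
    (h : ∀ x j, j ≠ τ.1 → T.hash2 .univ x j = T'.hash2 .univ x j) :
    keySet π τ T = keySet π τ T' := by
  ext x
  rw [mem_keySet, mem_keySet]
  refine and_congr_right fun _ => forall_congr' fun k => ?_
  rw [h]
  intro e
  have := congrArg Fin.val e
  simp at this
  omega

/-- Decoupling of the tables of the characters in `A` and of the derived character `τ.1`. -/
theorem sum_quadSum_le_decoupledSum {p : ℝ} (hp : 1 ≤ p) (s : ℕ) (A : Finset (Fin c))
    (π : PartialKey b c) (τ : Prefix b d) (w : Key b c → ℝ) :
    ∑ ω : MixedTables b r c d × MixedTables b r c d,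
      |quadSum s (keySet π τ ω.1) (fun x y => (∀ k ∈ A, x k ≠ y k) ∧
        ω.1.hash2 .univ x τ.1 ≠ ω.1.hash2 .univ y τ.1) ω.1 ω.1 w| ^ p ≤
      (4 ^ p) ^ (A.card + 1) * ∑ ω : MixedTables b r c d × MixedTables b r c d,
        |decoupledSum (s := s) (keySet π τ ω.1) (ω.1.decHash ω.1 A τ.1) (ω.1.decSign ω.1 A τ.1)
          (ω.1.decHash ω.2 A τ.1) (ω.1.decSign ω.2 A τ.1) w| ^ p := by
  rw [Fintype.sum_prod_type, Fintype.sum_prod_type]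
  simp only [decHash_eq_hash_mix, decSign_eq_sign_mix, mix_self, decoupledSum_eq_quadSum]
  -- The tables `h₃`, `σ₃` must be decoupled before the characters: the condition that `h₂ x` and
  -- `h₂ y` differ at `τ.1` would not survive resampling `h₂`, and this step removes it.
  have h1 := sum_quadSum_self_le hp (s := s) τ.1 (fun T : MixedTables b r c d => keySet π τ T)
    (fun T f => keySet_congr π τ fun x j _ => rfl) (fun x y => ∀ k ∈ A, x k ≠ y k) w
  have h2 := sum_quadSum_mix_le hp (s := s) A τ.1
    (fun T : MixedTables b r c d => keySet π τ T)
    (fun k T f => keySet_congr π τ fun x j hj => hash2_setChar_of_ne k hj T f x)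
    (fun _ _ => True) w
  simp only [true_and] at h2
  calc _ = _ := by simp only [Finset.sum_const, Finset.card_univ, nsmul_eq_mul, Finset.mul_sum]
    _ ≤ _ := h1
    _ ≤ 4 ^ p * _ := mul_le_mul_of_nonneg_left h2 (by positivity)
    _ = _ := by rw [pow_succ]; ring

/-! ### Second moment of the contribution of keys that collide under `h₂`. -/

/-- The four elements can be split into two pairs of equal elements. -/
def Paired {A : Type*} (a a' b b' : A) : Prop :=
  (a = a' ∧ b = b') ∨ (a = b ∧ a' = b') ∨ (a = b' ∧ a' = b)

/-- If the elements do not pair up, some value `α` occurs among them an odd number of times. -/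
theorem exists_prod_sign_eq_neg_one {A : Type*} [DecidableEq A] {a a' b b' : A}
    (h : ¬ Paired a a' b b') : ∃ α : A,
      (if a = α then -1 else 1) * (if a' = α then -1 else 1) * (if b = α then -1 else 1) *
        (if b' = α then -1 else 1) = (-1 : ℝ) := by
  simp only [Paired, not_or, not_and] at h
  obtain ⟨h1, h2, h3⟩ := h
  by_cases e1 : a = a'
  · exact ⟨b, by have := h1 e1; by_cases e : a' = b <;> simp [e1, e, Ne.symm this]⟩
  · by_cases e2 : a = b
    · exact ⟨a', by have := h2 e2; subst e2; simp [e1, Ne.symm this]⟩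
    · by_cases e3 : a = b'
      · exact ⟨a', by have := h3 e3; subst e3; simp [e1, Ne.symm this]⟩
      · exact ⟨a, by simp [Ne.symm e1, Ne.symm e2, Ne.symm e3]⟩

theorem ite_le_ite_add_ite_add_ite {P Q R S : Prop} [Decidable P] [Decidable Q] [Decidable R]
    [Decidable S] (hS : S → P ∨ Q ∨ R) {v : ℝ} (h : 0 ≤ v) :
    (if S then v else 0) ≤
      (if P then v else 0) + (if Q then v else 0) + (if R then v else 0) := by
  split_ifs <;> first | linarith | tauto

open Classical in
-- Each of the three pairings turns the sum into a product of two inner products, bounded by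
-- Cauchy–Schwarz.
theorem sum_paired_le {A : Type*} [Fintype A] {f f' g g' : A → ℝ} (hf : ∀ a, 0 ≤ f a)
    (hf' : ∀ a, 0 ≤ f' a) (hg : ∀ a, 0 ≤ g a) (hg' : ∀ a, 0 ≤ g' a) :
    ∑ a, ∑ a', ∑ b, ∑ b', (if Paired a a' b b' then f a * f' a' * g b * g' b' else 0) ≤
      3 * (√(∑ a, f a ^ 2) * √(∑ a, f' a ^ 2) * √(∑ a, g a ^ 2) * √(∑ a, g' a ^ 2)) := by
  have cs : ∀ u v : A → ℝ, ∑ a, u a * v a ≤ √(∑ a, u a ^ 2) * √(∑ a, v a ^ 2) :=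
    fun u v => Real.sum_mul_le_sqrt_mul_sqrt _ u v
  have pos : ∀ u v : A → ℝ, (∀ a, 0 ≤ u a) → (∀ a, 0 ≤ v a) → 0 ≤ ∑ a, u a * v a :=
    fun u v hu hv => Finset.sum_nonneg fun a _ => mul_nonneg (hu a) (hv a)
  have h1 : (∑ a, f a * f' a) * ∑ b, g b * g' b ≤
      √(∑ a, f a ^ 2) * √(∑ a, f' a ^ 2) * (√(∑ a, g a ^ 2) * √(∑ a, g' a ^ 2)) :=
    mul_le_mul (cs _ _) (cs _ _) (pos _ _ hg hg') (by positivity)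
  have h2 : (∑ a, f a * g a) * ∑ b, f' b * g' b ≤
      √(∑ a, f a ^ 2) * √(∑ a, g a ^ 2) * (√(∑ a, f' a ^ 2) * √(∑ a, g' a ^ 2)) :=
    mul_le_mul (cs _ _) (cs _ _) (pos _ _ hf' hg') (by positivity)
  have h3 : (∑ a, f a * g' a) * ∑ b, f' b * g b ≤
      √(∑ a, f a ^ 2) * √(∑ a, g' a ^ 2) * (√(∑ a, f' a ^ 2) * √(∑ a, g a ^ 2)) :=
    mul_le_mul (cs _ _) (cs _ _) (pos _ _ hf' hg) (by positivity)
  have e1 : ∑ a, ∑ a', ∑ b, ∑ b', (if a = a' ∧ b = b' then f a * f' a' * g b * g' b' else 0) =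
      (∑ a, f a * f' a) * ∑ b, g b * g' b := by
    simp only [ite_and, Finset.sum_ite_eq, Finset.mem_univ, if_true, Finset.sum_ite_irrel,
      Finset.sum_const_zero]
    rw [Finset.sum_mul_sum]
    simp only [mul_assoc]
  have e2 : ∑ a, ∑ a', ∑ b, ∑ b', (if a = b ∧ a' = b' then f a * f' a' * g b * g' b' else 0) =
      (∑ a, f a * g a) * ∑ b, f' b * g' b := by
    simp only [ite_and, Finset.sum_ite_eq, Finset.mem_univ, if_true, Finset.sum_ite_irrel,
      Finset.sum_const_zero]
    rw [Finset.sum_mul_sum]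
    exact Finset.sum_congr rfl fun a _ => Finset.sum_congr rfl fun a' _ => by ring
  have e3 : ∑ a, ∑ a', ∑ b, ∑ b', (if a = b' ∧ a' = b then f a * f' a' * g b * g' b' else 0) =
      (∑ a, f a * g' a) * ∑ b, f' b * g b := by
    simp only [ite_and, Finset.sum_ite_eq, Finset.mem_univ, if_true]
    rw [Finset.sum_mul_sum]
    exact Finset.sum_congr rfl fun a _ => Finset.sum_congr rfl fun a' _ => by ring
  calc _ ≤ ∑ a, ∑ a', ∑ b, ∑ b', ((if a = a' ∧ b = b' then f a * f' a' * g b * g' b' else 0) +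
        (if a = b ∧ a' = b' then f a * f' a' * g b * g' b' else 0) +
        (if a = b' ∧ a' = b then f a * f' a' * g b * g' b' else 0)) := by
        refine Finset.sum_le_sum fun a _ => Finset.sum_le_sum fun a' _ =>
          Finset.sum_le_sum fun b _ => Finset.sum_le_sum fun b' _ => ?_
        have h : 0 ≤ f a * f' a' * g b * g' b' :=
          mul_nonneg (mul_nonneg (mul_nonneg (hf _) (hf' _)) (hg _)) (hg' _)
        exact ite_le_ite_add_ite_add_ite (S := Paired a a' b b') (fun q => q) h
    _ = (∑ a, f a * f' a) * ∑ b, g b * g' b + (∑ a, f a * g a) * ∑ b, f' b * g' b +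
        (∑ a, f a * g' a) * ∑ b, f' b * g b := by
        simp only [Finset.sum_add_distrib, e1, e2, e3]
    _ ≤ _ := by linarith

theorem sum_fin_succ_pi {A : Type*} [Fintype A] (n : ℕ) (F : (Fin (n + 1) → A) → ℝ) :
    ∑ x, F x = ∑ a, ∑ x : Fin n → A, F (Fin.cons a x) := by
  classical
  rw [← (Fin.consEquiv fun _ : Fin (n + 1) => A).sum_comp F, Fintype.sum_prod_type]
  rfl

open Classical in
/-- The weighted count of the quadruples of keys in which the characters at every position can be
split into two pairs of equal characters. -/
theorem sum_forall_paired_le {A : Type*} [Fintype A] (n : ℕ) {f f' g g' : (Fin n → A) → ℝ}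
    (hf : ∀ a, 0 ≤ f a) (hf' : ∀ a, 0 ≤ f' a) (hg : ∀ a, 0 ≤ g a) (hg' : ∀ a, 0 ≤ g' a) :
    ∑ x, ∑ x', ∑ y, ∑ y', (if ∀ k, Paired (x k) (x' k) (y k) (y' k) then
        f x * f' x' * g y * g' y' else 0) ≤
      3 ^ n * (√(∑ a, f a ^ 2) * √(∑ a, f' a ^ 2) * √(∑ a, g a ^ 2) * √(∑ a, g' a ^ 2)) := by
  induction n with
  | zero =>
    simp only [IsEmpty.forall_iff, if_true, pow_zero, one_mul, Fintype.sum_unique]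
    rw [Real.sqrt_sq (hf _), Real.sqrt_sq (hf' _), Real.sqrt_sq (hg _), Real.sqrt_sq (hg' _)]
  | succ n ih =>
    -- The norm of `u` is the norm of the function sending `a` to the norm of the section of `u` at
    -- first character `a`. The four sections differ in general, so the induction needs four
    -- separate functions.
    have hsq : ∀ u : (Fin (n + 1) → A) → ℝ, √(∑ x, u x ^ 2) =
        √(∑ a, √(∑ x : Fin n → A, u (Fin.cons a x) ^ 2) ^ 2) := by
      intro u
      rw [sum_fin_succ_pi]
      congr 1
      exact Finset.sum_congr rfl fun a _ =>
        (Real.sq_sqrt (Finset.sum_nonneg fun _ _ => sq_nonneg _)).symm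
    rw [hsq f, hsq f', hsq g, hsq g']
    simp only [sum_fin_succ_pi n]
    simp only [Fin.forall_fin_succ, Fin.cons_zero, Fin.cons_succ]
    have comm : ∀ F : A → (Fin n → A) → A → (Fin n → A) → A → (Fin n → A) → A → (Fin n → A) → ℝ,
        ∑ a, ∑ x, ∑ a', ∑ x', ∑ b, ∑ y, ∑ b', ∑ y', F a x a' x' b y b' y' =
        ∑ a, ∑ a', ∑ b, ∑ b', ∑ x, ∑ x', ∑ y, ∑ y', F a x a' x' b y b' y' := by
      intro F
      refine Finset.sum_congr rfl fun a _ => ?_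
      rw [Finset.sum_comm]
      refine Finset.sum_congr rfl fun a' _ => ?_
      simp only [Finset.sum_comm (s := (Finset.univ : Finset (Fin n → A)))
        (t := (Finset.univ : Finset A))]
    rw [comm]
    have step := sum_paired_le (f := fun a => √(∑ x : Fin n → A, f (Fin.cons a x) ^ 2))
      (f' := fun a => √(∑ x : Fin n → A, f' (Fin.cons a x) ^ 2))
      (g := fun a => √(∑ x : Fin n → A, g (Fin.cons a x) ^ 2))
      (g' := fun a => √(∑ x : Fin n → A, g' (Fin.cons a x) ^ 2))
      (fun _ => Real.sqrt_nonneg _) (fun _ => Real.sqrt_nonneg _) (fun _ => Real.sqrt_nonneg _)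
      (fun _ => Real.sqrt_nonneg _)
    have step' := mul_le_mul_of_nonneg_left step (by positivity : (0 : ℝ) ≤ 3 ^ n)
    rw [← mul_assoc, ← pow_succ] at step'
    refine le_trans ?_ step'
    simp only [Finset.mul_sum]
    refine Finset.sum_le_sum fun a _ => Finset.sum_le_sum fun a' _ =>
          Finset.sum_le_sum fun b _ => Finset.sum_le_sum fun b' _ => ?_
    by_cases h : Paired a a' b b'
    · simp only [h, true_and, if_true]
      exact ih (fun _ => hf _) (fun _ => hf' _) (fun _ => hg _) (fun _ => hg' _)
    · simp [h]

namespace MixedTables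

/-- The tables `T` with the sign for the character `α` at the position `k` flipped. -/
def flipSign (k : Fin c) (α : Bits b) (T : MixedTables b r c d) : MixedTables b r c d where
  h1 := T.h1
  s1 k' β := if k' = k ∧ β = α then -T.s1 k' β else T.s1 k' β
  h2 := T.h2
  h3 := T.h3
  s3 := T.s3

theorem flipSign_involutive (k : Fin c) (α : Bits b) :
    Function.Involutive (flipSign k α : MixedTables b r c d → MixedTables b r c d) := by
  intro T
  cases T
  simp only [flipSign, MixedTables.mk.injEq, true_and, and_true]
  ext
  split_ifs <;> simp_all

theorem sgn_sign1_flipSign (k : Fin c) (α : Bits b) (T : MixedTables b r c d) (x : Key b c) :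
    sgn ((flipSign k α T).sign1 .univ x) = (if x k = α then -1 else 1) * sgn (T.sign1 .univ x) := by
  by_cases h : x k = α
  · rw [if_pos h, neg_one_mul, ← sgn_neg]
    congr 1
    exact prod_eq_neg_prod k fun j => by
      by_cases hj : j = k
      · subst hj; simp [flipSign, h]
      · simp [flipSign, hj]
  · rw [if_neg h, one_mul]
    congr 1
    refine Finset.prod_congr rfl fun j _ => ?_
    have : ¬ (j = k ∧ x j = α) := by rintro ⟨rfl, h'⟩; exact h h'
    simp [flipSign, this]

/-- The tables `T` with the entries of `h₁` and `h₂` for the character `α` at the position `k`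
shifted by `q`. -/
def shiftEntry (k : Fin c) (α : Bits b) (T : MixedTables b r c d)
    (q : Bits r × (Fin d → Bits b)) : MixedTables b r c d where
  h1 k' β := T.h1 k' β + if k' = k ∧ β = α then q.1 else 0
  s1 := T.s1
  h2 k' β := T.h2 k' β + if k' = k ∧ β = α then q.2 else 0
  h3 := T.h3
  s3 := T.s3

theorem shiftEntry_neg (k : Fin c) (α : Bits b) (T : MixedTables b r c d)
    (q : Bits r × (Fin d → Bits b)) : shiftEntry k α (shiftEntry k α T q) (-q) = T := by
  cases T
  simp only [shiftEntry, MixedTables.mk.injEq, true_and, and_true, Prod.fst_neg, Prod.snd_neg]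
  refine ⟨?_, ?_⟩ <;> ext1 <;> ext1 <;> split_ifs <;> simp

theorem hash1_shiftEntry (k : Fin c) (α : Bits b) (T : MixedTables b r c d)
    (q : Bits r × (Fin d → Bits b)) (x : Key b c) :
    (shiftEntry k α T q).hash1 .univ x = T.hash1 .univ x + if x k = α then q.1 else 0 := by
  rw [hash1]
  simp only [shiftEntry, Finset.sum_add_distrib, ite_and, Finset.sum_ite_eq', Finset.mem_univ,
    if_true, hash1]

theorem hash2_shiftEntry (k : Fin c) (α : Bits b) (T : MixedTables b r c d)
    (q : Bits r × (Fin d → Bits b)) (x : Key b c) :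
    (shiftEntry k α T q).hash2 .univ x = T.hash2 .univ x + if x k = α then q.2 else 0 := by
  rw [hash2]
  simp only [shiftEntry, Finset.sum_add_distrib, ite_and, Finset.sum_ite_eq', Finset.mem_univ,
    if_true, hash2]

/-- The keys `x` and `y` collide under `h₁` and `h₂`. -/
def Collide (T : MixedTables b r c d) (x y : Key b c) : Prop :=
  T.hash1 .univ x = T.hash1 .univ y ∧ T.hash2 .univ x = T.hash2 .univ y

end MixedTables

open Classical in
-- At a position where the keys differ, shifting the entry read by `x` moves `(h₁ x, h₂ x)` by the
-- same amount and leaves `y` alone, so exactly one shift produces a collision.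
theorem sum_collide_eq {x y : Key b c} (hxy : x ≠ y) :
    ((2 : ℝ) ^ r * (2 ^ b) ^ d) *
        ∑ T : MixedTables b r c d, (if T.Collide x y then (1 : ℝ) else 0) =
      Fintype.card (MixedTables b r c d) := by
  obtain ⟨k, hk⟩ := Function.ne_iff.1 hxy
  have h := sum_sum_resample (fun (T : MixedTables b r c d) q => shiftEntry k (x k) T q)
    (fun _ q => -q) (fun T q => shiftEntry_neg k (x k) T q) (fun T q => neg_neg q)
    (fun T _ => if T.Collide x y then (1 : ℝ) else 0)
  have hc : ∀ (T : MixedTables b r c d) (q : Bits r × (Fin d → Bits b)),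
      (shiftEntry k (x k) T q).Collide x y ↔
        (T.hash1 .univ y - T.hash1 .univ x, T.hash2 .univ y - T.hash2 .univ x) = q := by
    intro T q
    rw [Collide, hash1_shiftEntry, hash1_shiftEntry, hash2_shiftEntry, hash2_shiftEntry,
      if_pos rfl, if_neg hk.symm, if_pos rfl, if_neg hk.symm, add_zero, add_zero, Prod.ext_iff,
      sub_eq_iff_eq_add', sub_eq_iff_eq_add', eq_comm, eq_comm (a := T.hash2 _ x + _)]
  simp only [hc, Finset.sum_ite_eq, Finset.mem_univ, if_true, Finset.sum_const, Finset.card_univ,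
    nsmul_eq_mul, mul_one, ← Finset.mul_sum] at h
  rw [h]
  simp

open Classical in
theorem abs_sum_collide_sign_le {x x' y y' : Key b c} (h : x ≠ x') :
    |∑ T : MixedTables b r c d, (if T.Collide x x' ∧ T.Collide y y' then
        sgn (T.sign1 .univ x) * sgn (T.sign1 .univ x') * sgn (T.sign1 .univ y) *
          sgn (T.sign1 .univ y') else 0)| ≤
      if ∀ k, Paired (x k) (x' k) (y k) (y' k) then
        Fintype.card (MixedTables b r c d) * ((2 : ℝ) ^ r * (2 ^ b) ^ d)⁻¹ else 0 := by
  split_ifs with hp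
  -- In the paired case the second collision is dropped and only the probability of the first is
  -- used.
  · rw [← sum_collide_eq h, mul_comm, inv_mul_cancel_left₀ (by positivity)]
    refine (Finset.abs_sum_le_sum_abs _ _).trans (Finset.sum_le_sum fun T _ => ?_)
    by_cases h1 : T.Collide x x' <;> by_cases h2 : T.Collide y y' <;>
      simp [h1, h2, abs_mul, abs_sgn]
  · obtain ⟨k, hk⟩ := not_forall.1 hp
    obtain ⟨α, hα⟩ := exists_prod_sign_eq_neg_one hk
    refine (abs_eq_zero.2 ?_).le
    -- Flipping the sign entry of a character with odd multiplicity negates the product of signs,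
    -- and collisions do not read signs.
    refine sum_eq_zero_of_neg (flipSign_involutive k α).toPerm _ fun T => ?_
    rw [Function.Involutive.coe_toPerm]
    have hc : ∀ u v, (flipSign k α T).Collide u v ↔ T.Collide u v := fun u v => Iff.rfl
    simp only [hc, sgn_sign1_flipSign]
    by_cases h0 : T.Collide x x' ∧ T.Collide y y'
    · rw [if_pos h0, if_pos h0]
      linear_combination (sgn (T.sign1 .univ x) * sgn (T.sign1 .univ x') *
        sgn (T.sign1 .univ y) * sgn (T.sign1 .univ y')) * hα
    · simp [h0]

open Classical in
/-- The part of the error given by the keys that collide under `h₂`. -/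
noncomputable def collideSum (T : MixedTables b r c d) (w : Key b c → ℝ) : ℝ :=
  ∑ x, ∑ y, if x ≠ y ∧ T.Collide x y then
    sgn (T.sign1 .univ x) * sgn (T.sign1 .univ y) * (w x * w y) else 0

theorem sum_collideSum_sq_le (w : Key b c → ℝ) :
    ∑ T : MixedTables b r c d, collideSum T w ^ 2 ≤
      Fintype.card (MixedTables b r c d) * ((2 : ℝ) ^ r * (2 ^ b) ^ d)⁻¹ *
        (3 ^ c * (∑ x, w x ^ 2) ^ 2) := by
  classical
  set C : ℝ := Fintype.card (MixedTables b r c d) * ((2 : ℝ) ^ r * (2 ^ b) ^ d)⁻¹ with hC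
  have h0 : ∀ T : MixedTables b r c d, collideSum T w ^ 2 = ∑ x, ∑ x', ∑ y, ∑ y',
      (if x ≠ x' ∧ y ≠ y' then w x * w x' * w y * w y' *
        (if T.Collide x x' ∧ T.Collide y y' then
          sgn (T.sign1 .univ x) * sgn (T.sign1 .univ x') * sgn (T.sign1 .univ y) *
          sgn (T.sign1 .univ y') else 0) else 0) := by
    intro T
    rw [sq, collideSum, Finset.sum_mul_sum]
    refine Finset.sum_congr rfl fun x _ => ?_
    simp only [Finset.sum_mul_sum]
    rw [Finset.sum_comm]
    refine Finset.sum_congr rfl fun x' _ => Finset.sum_congr rfl fun y _ =>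
      Finset.sum_congr rfl fun y' _ => ?_
    by_cases h1 : x ≠ x' <;> by_cases h2 : y ≠ y' <;> by_cases h3 : T.Collide x x' <;>
      by_cases h4 : T.Collide y y' <;> simp [h1, h2, h3, h4]
    ring
  have h1 : ∑ T : MixedTables b r c d, collideSum T w ^ 2 = ∑ x, ∑ x', ∑ y, ∑ y',
      (if x ≠ x' ∧ y ≠ y' then w x * w x' * w y * w y' *
        (∑ T : MixedTables b r c d, if T.Collide x x' ∧ T.Collide y y' then
          sgn (T.sign1 .univ x) * sgn (T.sign1 .univ x') * sgn (T.sign1 .univ y) *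
          sgn (T.sign1 .univ y') else 0) else 0) := by
    simp only [h0]
    rw [Finset.sum_comm]
    refine Finset.sum_congr rfl fun x _ => ?_
    rw [Finset.sum_comm]
    refine Finset.sum_congr rfl fun x' _ => ?_
    rw [Finset.sum_comm]
    refine Finset.sum_congr rfl fun y _ => ?_
    rw [Finset.sum_comm]
    refine Finset.sum_congr rfl fun y' _ => ?_
    split_ifs
    · rw [Finset.mul_sum]
    · simp
  have h2 := sum_forall_paired_le (A := Bits b) c (f := fun x => |w x|) (f' := fun x => |w x|)
    (g := fun x => |w x|) (g' := fun x => |w x|) (fun _ => abs_nonneg _) (fun _ => abs_nonneg _)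
    (fun _ => abs_nonneg _) (fun _ => abs_nonneg _)
  have h3 : √(∑ a, |w a| ^ 2) * √(∑ a, |w a| ^ 2) * √(∑ a, |w a| ^ 2) * √(∑ a, |w a| ^ 2) =
      (∑ x, w x ^ 2) ^ 2 := by
    simp only [sq_abs]
    have h4 : √(∑ a, w a ^ 2) * √(∑ a, w a ^ 2) = ∑ a, w a ^ 2 :=
      Real.mul_self_sqrt (Finset.sum_nonneg fun _ _ => sq_nonneg _)
    rw [h4, mul_assoc, h4, sq]
  rw [h3] at h2
  have hC0 : 0 ≤ C := by positivity
  rw [h1]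
  refine le_trans ?_ (mul_le_mul_of_nonneg_left h2 hC0)
  simp only [Finset.mul_sum]
  refine Finset.sum_le_sum fun x _ => Finset.sum_le_sum fun x' _ =>
    Finset.sum_le_sum fun y _ => Finset.sum_le_sum fun y' _ => ?_
  by_cases hne : x ≠ x' ∧ y ≠ y'
  · rw [if_pos hne]
    have h5 := abs_sum_collide_sign_le (r := r) (d := d) (y := y) (y' := y') hne.1
    refine (le_abs_self _).trans ?_
    rw [← Finset.mul_sum, abs_mul, abs_mul, abs_mul, abs_mul]
    refine (mul_le_mul_of_nonneg_left h5 (by positivity)).trans (le_of_eq ?_)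
    split_ifs
    · rw [hC]; ring
    · simp
  · rw [if_neg hne]
    split_ifs <;> positivity

/-- When `h₂ x = h₂ y` the two keys get the same `h₃` value and the two `σ₃` factors multiply to 1,
so the term is the same for all `i` and the average over `i` disappears. -/
theorem errorZ_eq {s : ℕ} (hs : 1 ≤ s) (T : MixedTables b r c d) (w : Key b c → ℝ) :
    errorZ (s := s) T.hash T.sign w =
      1 / s * quadSum s Finset.univ (fun x y => T.hash2 .univ x ≠ T.hash2 .univ y) T T w +
        collideSum T w := by
  classical
  have hs0 : (s : ℝ) ≠ 0 := by positivity
  have h1 : collideSum T w = 1 / s * ∑ _i : Fin s, collideSum T w := by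
    simp [hs0]
  rw [h1, ← mul_add, errorZ]
  congr 1
  have h2 : quadSum s Finset.univ (fun x y => T.hash2 .univ x ≠ T.hash2 .univ y) T T w =
      ∑ i : Fin s, ∑ x, ∑ y, if T.hash2 .univ x ≠ T.hash2 .univ y then
        quadTerm T T w (i, x, y) else 0 := by
    simp only [quadSum, Finset.mem_univ, true_and, Finset.sum_filter, Fintype.sum_prod_type]
  rw [h2, ← Finset.sum_add_distrib]
  refine Finset.sum_congr rfl fun i _ => ?_
  rw [collideSum, ← Finset.sum_add_distrib]
  refine Finset.sum_congr rfl fun x _ => ?_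
  rw [← Finset.sum_add_distrib]
  refine Finset.sum_congr rfl fun y _ => ?_
  by_cases hxy : x = y
  · subst hxy; simp
  by_cases h : T.hash2 .univ x = T.hash2 .univ y
  · have e1 : T.hash i x = T.hash i y ↔ T.hash1 .univ x = T.hash1 .univ y := by
      rw [MixedTables.hash, MixedTables.hash, h, add_left_inj]
    have e2 : sgn (T.sign i x) * sgn (T.sign i y) =
        sgn (T.sign1 .univ x) * sgn (T.sign1 .univ y) := by
      rw [MixedTables.sign, MixedTables.sign, h, sgn_mul, sgn_mul, mul_mul_mul_comm, sgn_mul_self, mul_one]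
    by_cases h' : T.hash1 .univ x = T.hash1 .univ y <;>
      simp [hxy, h, e1, e2, h', Collide, mul_assoc]
  · simp [hxy, h, Collide, quadTerm]

/-! ### Uniform measures as normalised sums, norms and Markov's inequality. -/

theorem tablesMeasure_singleton (T : MixedTables b r c d) :
    tablesMeasure b r c d {T} = (Fintype.card (MixedTables b r c d) : ENNReal)⁻¹ := by
  rw [tablesMeasure, uniformOn_univ, Measure.count_singleton, one_div]

theorem tablesMeasure_real_singleton (T : MixedTables b r c d) :
    (tablesMeasure b r c d).real {T} = (Fintype.card (MixedTables b r c d) : ℝ)⁻¹ := by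
  rw [measureReal_def, tablesMeasure_singleton]
  simp

instance instIsProbabilityMeasurePairMeasure (b r c d : ℕ) :
    IsProbabilityMeasure (pairMeasure b r c d) := by
  unfold pairMeasure; infer_instance

theorem pairMeasure_real_singleton (ω : MixedTables b r c d × MixedTables b r c d) :
    (pairMeasure b r c d).real {ω} =
      (Fintype.card (MixedTables b r c d × MixedTables b r c d) : ℝ)⁻¹ := by
  obtain ⟨T, F⟩ := ω
  rw [pairMeasure, ← Set.singleton_prod_singleton, measureReal_prod_prod,
    tablesMeasure_real_singleton, tablesMeasure_real_singleton, Fintype.card_prod, Nat.cast_mul,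
    mul_inv]

theorem integral_pairMeasure (f : MixedTables b r c d × MixedTables b r c d → ℝ) :
    ∫ ω, f ω ∂pairMeasure b r c d =
      (Fintype.card (MixedTables b r c d × MixedTables b r c d) : ℝ)⁻¹ * ∑ ω, f ω := by
  rw [integral_fintype Integrable.of_finite, Finset.mul_sum]
  simp only [pairMeasure_real_singleton, smul_eq_mul]

open Classical in
theorem measureReal_eq_sum {Ω : Type*} [Fintype Ω] [MeasurableSpace Ω]
    [MeasurableSingletonClass Ω] (μ : Measure Ω) [IsFiniteMeasure μ] {C : ℝ}
    (h : ∀ ω, μ.real {ω} = C) (S : Set Ω) :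
    μ.real S = C * ∑ ω, if ω ∈ S then (1 : ℝ) else 0 := by
  have h1 : S = ((Finset.univ.filter fun ω => ω ∈ S : Finset Ω) : Set Ω) := by ext; simp
  conv_lhs => rw [h1]
  rw [← sum_measureReal_singleton]
  simp [h, mul_comm]

open Classical in
theorem pairMeasure_real_eq (S : Set (MixedTables b r c d × MixedTables b r c d)) :
    (pairMeasure b r c d).real S =
      (Fintype.card (MixedTables b r c d × MixedTables b r c d) : ℝ)⁻¹ *
        ∑ ω, if ω ∈ S then (1 : ℝ) else 0 :=
  measureReal_eq_sum _ pairMeasure_real_singleton S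

open Classical in
theorem tablesMeasure_real_eq (S : Set (MixedTables b r c d)) :
    (tablesMeasure b r c d).real S =
      (Fintype.card (MixedTables b r c d) : ℝ)⁻¹ * ∑ ω, if ω ∈ S then (1 : ℝ) else 0 :=
  measureReal_eq_sum _ tablesMeasure_real_singleton S

theorem pNorm_pairMeasure (p : ℝ)
    (X : MixedTables b r c d × MixedTables b r c d → ℝ) :
    pNorm (pairMeasure b r c d) p X =
      ((Fintype.card (MixedTables b r c d × MixedTables b r c d) : ℝ)⁻¹) ^ (1 / p) *
        (∑ ω, |X ω| ^ p) ^ (1 / p) := by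
  rw [pNorm, integral_pairMeasure, Real.mul_rpow (by positivity) (by positivity)]

theorem pNorm_nonneg {Ω : Type*} [MeasurableSpace Ω] (μ : Measure Ω) (p : ℝ) (X : Ω → ℝ) :
    0 ≤ pNorm μ p X :=
  Real.rpow_nonneg (integral_nonneg fun _ => Real.rpow_nonneg (abs_nonneg _) _) _

theorem pNorm_sum_le {p : ℝ} (hp : 1 ≤ p) {A : Type*} (S : Finset A)
    (X : A → MixedTables b r c d × MixedTables b r c d → ℝ) :
    pNorm (pairMeasure b r c d) p (fun ω => ∑ α ∈ S, X α ω) ≤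
      ∑ α ∈ S, pNorm (pairMeasure b r c d) p (X α) := by
  classical
  have hp0 : 0 < p := by linarith
  induction S using Finset.induction_on with
  | empty =>
    simp only [Finset.sum_empty]
    rw [pNorm_pairMeasure p]
    simp [Real.zero_rpow hp0.ne', Real.zero_rpow (inv_ne_zero hp0.ne')]
  | insert α S hα ih =>
    simp only [Finset.sum_insert hα]
    refine le_trans ?_ (add_le_add_right ih _)
    simp only [pNorm_pairMeasure p]
    rw [← mul_add]
    exact mul_le_mul_of_nonneg_left (Real.Lp_add_le _ _ _ hp) (by positivity)

theorem pNorm_le_of_sum_le {p C : ℝ} (hp : 0 < p) (hC : 0 ≤ C)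
    {X Y : MixedTables b r c d × MixedTables b r c d → ℝ}
    (h : ∑ ω, |X ω| ^ p ≤ C ^ p * ∑ ω, |Y ω| ^ p) :
    pNorm (pairMeasure b r c d) p X ≤ C * pNorm (pairMeasure b r c d) p Y := by
  rw [pNorm_pairMeasure p, pNorm_pairMeasure p, mul_left_comm]
  refine mul_le_mul_of_nonneg_left ?_ (by positivity)
  refine (Real.rpow_le_rpow (by positivity) h (by positivity)).trans (le_of_eq ?_)
  rw [Real.mul_rpow (by positivity) (by positivity), ← Real.rpow_mul hC, mul_one_div_cancel hp.ne',
    Real.rpow_one]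

theorem pNorm_const_mul {p : ℝ} (hp : 0 < p) {C : ℝ} (hC : 0 ≤ C)
    (X : MixedTables b r c d × MixedTables b r c d → ℝ) :
    pNorm (pairMeasure b r c d) p (fun ω => C * X ω) ≤ C * pNorm (pairMeasure b r c d) p X := by
  refine pNorm_le_of_sum_le hp hC (le_of_eq ?_)
  rw [Finset.mul_sum]
  exact Finset.sum_congr rfl fun ω _ => by
    rw [abs_mul, abs_of_nonneg hC, Real.mul_rpow hC (abs_nonneg _)]

theorem pairMeasure_real_le_abs_le {p a : ℝ} (hp : 0 < p) (ha : 0 < a)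
    (X : MixedTables b r c d × MixedTables b r c d → ℝ) :
    (pairMeasure b r c d).real {ω | a ≤ |X ω|} ≤
      (a ^ p)⁻¹ * ((Fintype.card (MixedTables b r c d × MixedTables b r c d) : ℝ)⁻¹ *
        ∑ ω, |X ω| ^ p) := by
  classical
  rw [pairMeasure_real_eq, mul_left_comm]
  refine mul_le_mul_of_nonneg_left ?_ (by positivity)
  rw [Finset.mul_sum]
  refine Finset.sum_le_sum fun ω _ => ?_
  have hap : 0 < a ^ p := Real.rpow_pos_of_pos ha p
  split_ifs with h
  · rw [← div_eq_inv_mul, one_le_div hap]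
    exact Real.rpow_le_rpow ha.le h hp.le
  · positivity

theorem pairMeasure_real_le_abs_le_pNorm {p a : ℝ} (hp : 0 < p) (ha : 0 < a)
    (X : MixedTables b r c d × MixedTables b r c d → ℝ) :
    (pairMeasure b r c d).real {ω | a ≤ |X ω|} ≤
      (a⁻¹ * pNorm (pairMeasure b r c d) p X) ^ p := by
  refine (pairMeasure_real_le_abs_le hp ha X).trans (le_of_eq ?_)
  rw [Real.mul_rpow (by positivity) (pNorm_nonneg _ _ _), Real.inv_rpow ha.le, pNorm,
    integral_pairMeasure, ← Real.rpow_mul (by positivity), one_div_mul_cancel hp.ne', Real.rpow_one]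

/-! ### The partition of the pairs that do not collide under `h₂`. -/

theorem sum_quadSum_eq (s : ℕ) {A : Type*} (S : Finset A) (U : A → Finset (Key b c))
    (Q : A → Key b c → Key b c → Prop) (R : Key b c → Key b c → Prop)
    (h1 : ∀ x y, R x y → ∃ α ∈ S, (x ∈ U α ∧ y ∈ U α ∧ Q α x y) ∧
      ∀ β ∈ S, x ∈ U β → y ∈ U β → Q β x y → β = α)
    (h2 : ∀ α ∈ S, ∀ x y, x ∈ U α → y ∈ U α → Q α x y → R x y)
    (T T' : MixedTables b r c d) (w : Key b c → ℝ) :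
    quadSum s .univ R T T' w = ∑ α ∈ S, quadSum s (U α) (Q α) T T' w := by
  classical
  simp only [quadSum, Finset.sum_filter, Finset.mem_univ, true_and]
  rw [Finset.sum_comm]
  refine Finset.sum_congr rfl fun j _ => ?_
  by_cases hR : R j.2.1 j.2.2
  · obtain ⟨α, hα, hQ, huniq⟩ := h1 _ _ hR
    rw [if_pos hR, Finset.sum_eq_single_of_mem α hα, if_pos hQ]
    intro β hβ hne
    exact if_neg fun hq => hne (huniq β hβ hq.1 hq.2.1 hq.2.2)
  · rw [if_neg hR, Finset.sum_eq_zero]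
    intro α hα
    exact if_neg fun hq => hR (h2 α hα _ _ hq.1 hq.2.1 hq.2.2)

theorem Prefix.exists_sub {z z' : Fin d → Bits b} (h : z ≠ z') :
    ∃ τ : Prefix b d, τ.Sub z ∧ τ.Sub z' ∧ z τ.1 ≠ z' τ.1 := by
  obtain ⟨t, ht, hmin⟩ := wellFounded_lt.has_min {t : Fin d | z t ≠ z' t} (Function.ne_iff.1 h)
  refine ⟨⟨t, fun k => z (Fin.castLE t.is_lt.le k)⟩, fun k => rfl, fun k => ?_, ht⟩
  by_contra hne
  exact hmin _ (Ne.symm hne) k.is_lt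

/-- A common prefix cannot extend past a coordinate where `z` and `z'` differ, so the lengths agree,
and `z` then determines the entries. -/
theorem Prefix.eq_of_sub {z z' : Fin d → Bits b} {τ τ' : Prefix b d} (h1 : τ.Sub z)
    (h2 : τ.Sub z') (h3 : z τ.1 ≠ z' τ.1) (h1' : τ'.Sub z) (h2' : τ'.Sub z')
    (h3' : z τ'.1 ≠ z' τ'.1) : τ = τ' := by
  have aux : ∀ {σ σ' : Prefix b d}, σ'.Sub z → σ'.Sub z' → z σ.1 ≠ z' σ.1 → ¬ σ.1 < σ'.1 := by
    intro σ σ' q q' hne hlt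
    exact hne ((q ⟨σ.1, hlt⟩).trans (q' ⟨σ.1, hlt⟩).symm)
  have e : τ.1 = τ'.1 := le_antisymm (not_lt.1 (aux h1 h2 h3')) (not_lt.1 (aux h1' h2' h3))
  obtain ⟨t, v⟩ := τ
  obtain ⟨t', v'⟩ := τ'
  obtain rfl : t = t' := e
  congr 1
  ext1 k
  exact (h1 k).symm.trans (h1' k)

/-- The common characters of two keys. -/
def commonKey (x y : Key b c) : PartialKey b c := fun k => if x k = y k then some (x k) else none

theorem eq_commonKey {π : PartialKey b c} {x y : Key b c} (hx : π.Sub x) (hy : π.Sub y)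
    (h : ∀ k ∈ π.positionsᶜ, x k ≠ y k) : π = commonKey x y := by
  ext1 k
  rw [commonKey]
  cases hk : π k with
  | none => rw [if_neg (h k (by simp [PartialKey.positions, hk]))]
  | some a => rw [if_pos ((hx k a hk).trans (hy k a hk).symm), hx k a hk]

theorem commonKey_sub (x y : Key b c) : (commonKey x y).Sub x ∧ (commonKey x y).Sub y ∧
    ∀ k ∈ (commonKey x y).positionsᶜ, x k ≠ y k := by
  refine ⟨fun k a h => ?_, fun k a h => ?_, fun k hk h => ?_⟩
  · rw [commonKey] at h
    split_ifs at h with e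
    exact Option.some.inj h
  · rw [commonKey] at h
    split_ifs at h with e
    exact e ▸ Option.some.inj h
  · simp [PartialKey.positions, commonKey, h] at hk

theorem quadSum_univ_eq_sum_commonKey (s : ℕ) (T : MixedTables b r c d) (w : Key b c → ℝ) :
    quadSum s .univ (fun x y => T.hash2 .univ x ≠ T.hash2 .univ y) T T w =
      ∑ α : PartialKey b c × Prefix b d, quadSum s (keySet α.1 α.2 T)
        (fun x y => (∀ k ∈ α.1.positionsᶜ, x k ≠ y k) ∧
          T.hash2 .univ x α.2.1 ≠ T.hash2 .univ y α.2.1) T T w := by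
  refine sum_quadSum_eq s _ _ _ _ (fun x y h => ?_) (fun α _ x y _ _ hQ e => hQ.2 (by rw [e])) T T w
  obtain ⟨τ, h1, h2, h3⟩ := Prefix.exists_sub h
  obtain ⟨q1, q2, q3⟩ := commonKey_sub x y
  refine ⟨(commonKey x y, τ), Finset.mem_univ _,
    ⟨mem_keySet.2 ⟨q1, h1⟩, mem_keySet.2 ⟨q2, h2⟩, q3, h3⟩, fun β _ hx hy hQ => ?_⟩
  rw [mem_keySet] at hx hy
  exact Prod.ext (eq_commonKey hx.1 hy.1 hQ.1) (Prefix.eq_of_sub hx.2 hy.2 hQ.2 h1 h2 h3)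

/-- The empty partial key has no positions, so the condition on the characters is void and the
prefix alone partitions the pairs; only `h₃`, `σ₃` are then decoupled. -/
theorem quadSum_univ_eq_sum_prefix (s : ℕ) (T : MixedTables b r c d) (w : Key b c → ℝ) :
    quadSum s .univ (fun x y => T.hash2 .univ x ≠ T.hash2 .univ y) T T w =
      ∑ α ∈ ({fun _ => none} ×ˢ Finset.univ : Finset (PartialKey b c × Prefix b d)),
        quadSum s (keySet α.1 α.2 T)
          (fun x y => (∀ k ∈ α.1.positions, x k ≠ y k) ∧
            T.hash2 .univ x α.2.1 ≠ T.hash2 .univ y α.2.1) T T w := by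
  refine sum_quadSum_eq s _ _ _ _ (fun x y h => ?_) (fun α _ x y _ _ hQ e => hQ.2 (by rw [e])) T T w
  obtain ⟨τ, h1, h2, h3⟩ := Prefix.exists_sub h
  refine ⟨(fun _ => none, τ), by simp, ⟨mem_keySet.2 ⟨by simp [PartialKey.Sub], h1⟩,
    mem_keySet.2 ⟨by simp [PartialKey.Sub], h2⟩, by simp [PartialKey.positions], h3⟩,
    fun β hβ hx hy hQ => ?_⟩
  rw [mem_keySet] at hx hy
  simp only [Finset.mem_product, Finset.mem_singleton] at hβ
  exact Prod.ext hβ.1 (Prefix.eq_of_sub hx.2 hy.2 hQ.2 h1 h2 h3)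

/-! ### The tail bound and the multiplicity of the sets of keys. -/

/-- The tail bound, given a decomposition of the part of the error that comes from the keys that
do not collide under `h₂`. -/
theorem pairMeasure_real_errorZ_le {p ε : ℝ} (hp : 1 ≤ p) (hε : 0 < ε) {s : ℕ} (hs : 1 ≤ s)
    (J : PartialKey b c → Finset (Fin c)) (S : Finset (PartialKey b c × Prefix b d))
    (w : Key b c → ℝ) (hw : ∑ x, w x ^ 2 = 1)
    (h : ∀ T : MixedTables b r c d,
      quadSum s .univ (fun x y => T.hash2 .univ x ≠ T.hash2 .univ y) T T w =
        ∑ α ∈ S, quadSum s (keySet α.1 α.2 T) (fun x y => (∀ k ∈ J α.1, x k ≠ y k) ∧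
            T.hash2 .univ x α.2.1 ≠ T.hash2 .univ y α.2.1) T T w) :
    (pairMeasure b r c d).real {ω | ε ≤ |errorZ (s := s) ω.1.hash ω.1.sign w|} ≤
      (ε⁻¹ * ∑ α ∈ S, (4 : ℝ) ^ (c + 2) / s *
        pNorm (pairMeasure b r c d) p (fun ω => decoupledSum (s := s) (keySet α.1 α.2 ω.1)
          (ω.1.decHash ω.1 (J α.1) α.2.1) (ω.1.decSign ω.1 (J α.1) α.2.1)
          (ω.1.decHash ω.2 (J α.1) α.2.1) (ω.1.decSign ω.2 (J α.1) α.2.1) w)) ^ p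
        + 4 * (ε ^ 2)⁻¹ * (3 ^ c * ((2 : ℝ) ^ r * (2 ^ b) ^ d)⁻¹) := by
  set X : PartialKey b c × Prefix b d → MixedTables b r c d × MixedTables b r c d → ℝ :=
    fun α ω => quadSum s (keySet α.1 α.2 ω.1) (fun x y => (∀ k ∈ J α.1, x k ≠ y k) ∧
      ω.1.hash2 .univ x α.2.1 ≠ ω.1.hash2 .univ y α.2.1) ω.1 ω.1 w with hX
  set D : PartialKey b c × Prefix b d → MixedTables b r c d × MixedTables b r c d → ℝ :=
    fun α ω => decoupledSum (s := s) (keySet α.1 α.2 ω.1)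
      (ω.1.decHash ω.1 (J α.1) α.2.1) (ω.1.decSign ω.1 (J α.1) α.2.1)
      (ω.1.decHash ω.2 (J α.1) α.2.1) (ω.1.decSign ω.2 (J α.1) α.2.1) w with hD
  have hp0 : 0 < p := by linarith
  have hXD : ∀ α, pNorm (pairMeasure b r c d) p (X α) ≤
      4 ^ (c + 1) * pNorm (pairMeasure b r c d) p (D α) := by
    intro α
    refine (pNorm_le_of_sum_le hp0 (by positivity : (0 : ℝ) ≤ 4 ^ ((J α.1).card + 1)) ?_).trans
      (mul_le_mul_of_nonneg_right ?_ (pNorm_nonneg _ _ _))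
    · rw [← Real.rpow_natCast_mul (by norm_num), mul_comm _ p,
        Real.rpow_mul_natCast (by norm_num)]
      exact sum_quadSum_le_decoupledSum hp s (J α.1) α.1 α.2 w
    · exact pow_le_pow_right₀ (by norm_num)
        (by have := Finset.card_le_univ (J α.1); simp at this; omega)
  -- One of the two parts of the error must reach `ε / 2`: the first is handled by its `p`-th
  -- moment, the colliding part by its second.
  have hsub : {ω : MixedTables b r c d × MixedTables b r c d |
      ε ≤ |errorZ (s := s) ω.1.hash ω.1.sign w|} ⊆
      {ω | ε / 2 ≤ |1 / s * ∑ α ∈ S, X α ω|} ∪ {ω | ε / 2 ≤ |collideSum ω.1 w|} := by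
    intro ω hω
    simp only [Set.mem_ofPred_eq, Set.mem_union, errorZ_eq hs, h] at hω ⊢
    by_contra hcon
    rw [not_or, not_le, not_le] at hcon
    have := (hω.trans (abs_add_le _ _))
    linarith [hcon.1, hcon.2]
  refine ((measureReal_mono hsub).trans (measureReal_union_le _ _)).trans (add_le_add ?_ ?_)
  · refine (pairMeasure_real_le_abs_le_pNorm hp0 (by positivity) _).trans
      (Real.rpow_le_rpow (mul_nonneg (by positivity) (pNorm_nonneg _ _ _)) ?_ hp0.le)
    have h1 : pNorm (pairMeasure b r c d) p (fun ω => 1 / s * ∑ α ∈ S, X α ω) ≤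
        1 / s * ∑ α ∈ S, 4 ^ (c + 1) * pNorm (pairMeasure b r c d) p (D α) :=
      (pNorm_const_mul hp0 (by positivity) _).trans (mul_le_mul_of_nonneg_left
        ((pNorm_sum_le hp S X).trans (Finset.sum_le_sum fun α _ => hXD α)) (by positivity))
    have h2 : 0 ≤ ∑ α ∈ S, pNorm (pairMeasure b r c d) p (D α) :=
      Finset.sum_nonneg fun α _ => pNorm_nonneg _ _ _
    rw [← Finset.mul_sum] at h1 ⊢
    calc _ ≤ (ε / 2)⁻¹ * (1 / s * (4 ^ (c + 1) *
            ∑ α ∈ S, pNorm (pairMeasure b r c d) p (D α))) := by gcongr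
      _ = ε⁻¹ * ((2 * 4 ^ (c + 1)) / s * ∑ α ∈ S, pNorm (pairMeasure b r c d) p (D α)) := by
          field_simp
      _ ≤ _ := by
          gcongr
          -- The factor 2 from `ε / 2` is absorbed by one more factor 4.
          rw [pow_succ 4 (c + 1)]
          linarith [pow_pos (by norm_num : (0 : ℝ) < 4) (c + 1)]
  · refine (pairMeasure_real_le_abs_le (p := 2) (by norm_num) (by positivity) _).trans ?_
    simp only [Real.rpow_two, sq_abs]
    have h1 := sum_collideSum_sq_le (r := r) (d := d) w
    rw [hw, one_pow, mul_one] at h1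
    have hN : (0 : ℝ) < Fintype.card (MixedTables b r c d) := by exact_mod_cast Fintype.card_pos
    rw [Fintype.sum_prod_type]
    simp only [Finset.sum_const, Finset.card_univ, nsmul_eq_mul, ← Finset.mul_sum]
    rw [Fintype.card_prod, Nat.cast_mul]
    calc _ ≤ ((ε / 2) ^ 2)⁻¹ * (((Fintype.card (MixedTables b r c d) : ℝ) *
            Fintype.card (MixedTables b r c d))⁻¹ * (Fintype.card (MixedTables b r c d) *
            (Fintype.card (MixedTables b r c d) * ((2 : ℝ) ^ r * (2 ^ b) ^ d)⁻¹ * 3 ^ c))) := by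
          gcongr
      _ = _ := by field_simp; ring

/-- A key contains `2 ^ c` partial keys, and a derived key has `d` proper prefixes. -/
theorem sum_sum_keySet_eq (T : MixedTables b r c d) (w : Key b c → ℝ) :
    ∑ π : PartialKey b c, ∑ τ : Prefix b d, ∑ x ∈ keySet π τ T, w x ^ 2 =
      d * 2 ^ c * ∑ x, w x ^ 2 := by
  classical
  have h1 : ∀ x : Key b c, ∑ π : PartialKey b c, (if π.Sub x then (1 : ℝ) else 0) = 2 ^ c := by
    intro x
    have : (Finset.univ.filter fun π : PartialKey b c => π.Sub x) =
        Fintype.piFinset fun k => {none, some (x k)} := by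
      ext π
      rw [Finset.mem_filter_univ, Fintype.mem_piFinset]
      refine forall_congr' fun k => ?_
      cases π k <;> simp [eq_comm]
    rw [Finset.sum_boole, this, Fintype.card_piFinset]
    simp
  have h2 : ∀ z : Fin d → Bits b, ∑ τ : Prefix b d, (if τ.Sub z then (1 : ℝ) else 0) = d := by
    intro z
    rw [Fintype.sum_sigma]
    have : ∀ (t : Fin d) (v : Fin t → Bits b), Prefix.Sub ⟨t, v⟩ z ↔
        (fun k => z (Fin.castLE t.is_lt.le k)) = v := fun t v => funext_iff.symm
    simp [this]
  have h3 : ∀ (π : PartialKey b c) (τ : Prefix b d), ∑ x ∈ keySet π τ T, w x ^ 2 =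
      ∑ x, (if π.Sub x then (1 : ℝ) else 0) * (if τ.Sub (T.hash2 .univ x) then (1 : ℝ) else 0) *
        w x ^ 2 := by
    intro π τ
    have : keySet π τ T = Finset.univ.filter fun x => π.Sub x ∧ τ.Sub (T.hash2 .univ x) := by
      ext x; simp [mem_keySet]
    rw [this, Finset.sum_filter]
    refine Finset.sum_congr rfl fun x _ => ?_
    by_cases q1 : π.Sub x <;> by_cases q2 : τ.Sub (T.hash2 .univ x) <;> simp [q1, q2]
  simp only [h3]
  calc _ = ∑ x, ∑ π : PartialKey b c, ∑ τ : Prefix b d, (if π.Sub x then (1 : ℝ) else 0) *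
        (if τ.Sub (T.hash2 .univ x) then (1 : ℝ) else 0) * w x ^ 2 := by
        exact (Finset.sum_congr rfl fun π _ => Finset.sum_comm).trans Finset.sum_comm
    _ = ∑ x, (d * 2 ^ c) * w x ^ 2 := by
        refine Finset.sum_congr rfl fun x _ => ?_
        simp only [← Finset.sum_mul, ← Finset.mul_sum, h1, h2]
        ring
    _ = _ := by rw [Finset.mul_sum]

/-! ### Equality of the laws, and the conditional law of the decoupled pair. -/

namespace MixedTables

theorem mix_mix_left {d' d'' : ℕ} (J : Finset (Fin c)) (t : Fin d) (t' : Fin d') (t'' : Fin d'')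
    (T : MixedTables b r c d) (N : MixedTables b r c d') (F : MixedTables b r c d'') :
    mix J t t'' (mix J t t' T N) F = mix J t t'' T F := by
  simp only [mix, MixedTables.mk.injEq]
  refine ⟨?_, ?_, ?_, ?_, ?_⟩ <;> ext <;> split_ifs <;> simp_all

theorem keySet_mix {d' : ℕ} (J : Finset (Fin c)) (π : PartialKey b c) (τ : Prefix b d)
    (t' : Fin d') (T : MixedTables b r c d) (F : MixedTables b r c d') :
    keySet π τ (mix J τ.1 t' T F) = keySet π τ T :=
  keySet_congr π τ fun x _ hj => hash2_mix_of_ne J τ.1 t' T F x hj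

/-- The tables `T` with the arguments of `h₃` and `σ₃` shifted by `v`. -/
def shiftDer (v : Bits b) (T : MixedTables b r c d) : MixedTables b r c d where
  h1 := T.h1
  s1 := T.s1
  h2 := T.h2
  h3 j z := T.h3 j (z + v)
  s3 j z := T.s3 j (z + v)

/-- `shiftDer v` as a permutation of the tables. -/
def shiftDerEquiv (v : Bits b) : MixedTables b r c d ≃ MixedTables b r c d where
  toFun := shiftDer v
  invFun := shiftDer (-v)
  left_inv T := by cases T; simp [shiftDer]
  right_inv T := by cases T; simp [shiftDer]

/-- The offset of the hash function `h_{I,t}`: the part that does not use `h_{1,I}`, `h_{2,I}^{t}`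
and `h_{3,t}`. -/
def hashOffset {s : ℕ} (T : MixedTables b r c d) (I : Finset (Fin c)) (t : Fin d) (i : Fin s)
    (x : Key b c) : Bits r :=
  T.hash1 Iᶜ x + T.hash3 {t}ᶜ (fun k => T.hash2 .univ x k + bitsOf b i)

/-- The sign that belongs to `hashOffset`. -/
def signOffset {s : ℕ} (T : MixedTables b r c d) (I : Finset (Fin c)) (t : Fin d) (i : Fin s)
    (x : Key b c) : ℤˣ :=
  T.sign1 Iᶜ x * T.sign3 {t}ᶜ (fun k => T.hash2 .univ x k + bitsOf b i)

theorem hash_mix_eq_shiftDer {s : ℕ} (J : Finset (Fin c)) (t : Fin d) (T : MixedTables b r c d)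
    (N : MixedTables b r c 1) (i : Fin s) (x : Key b c) :
    (mix J t 0 T N).hash i x = T.hashOffset J t i x +
      ((shiftDer (T.hash2 Jᶜ x t) N).hash1 J x + (shiftDer (T.hash2 Jᶜ x t) N).hash3 .univ
        (fun k => (shiftDer (T.hash2 Jᶜ x t) N).hash2 J x k + bitsOf b i)) := by
  rw [hash_mix, add_comm, hashOffset]
  simp only [hash3, Fin.sum_univ_one]
  rfl

theorem sign_mix_eq_shiftDer {s : ℕ} (J : Finset (Fin c)) (t : Fin d) (T : MixedTables b r c d)
    (N : MixedTables b r c 1) (i : Fin s) (x : Key b c) :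
    (mix J t 0 T N).sign i x = T.signOffset J t i x *
      ((shiftDer (T.hash2 Jᶜ x t) N).sign1 J x * (shiftDer (T.hash2 Jᶜ x t) N).sign3 .univ
        (fun k => (shiftDer (T.hash2 Jᶜ x t) N).hash2 J x k + bitsOf b i)) := by
  rw [sign_mix, mul_comm, signOffset]
  simp only [sign3, Fin.prod_univ_one]
  rfl

end MixedTables

theorem hash2_positions_eq {π : PartialKey b c} {x y : Key b c} (hx : π.Sub x) (hy : π.Sub y)
    (T : MixedTables b r c d) : T.hash2 π.positions x = T.hash2 π.positions y := by
  refine Finset.sum_congr rfl fun k hk => ?_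
  obtain ⟨a, ha⟩ := Option.isSome_iff_exists.1 (Finset.mem_filter.1 hk).2
  rw [hx k a ha, hy k a ha]

/-- On keys that contain `π`, Mixed Tabulation with fresh tables for the remaining characters and
one derived character is an offset Mixed Tabulation. -/
theorem sum_mix_eq_offsetLaw {s : ℕ} (π : PartialKey b c) (t : Fin d) {V : Finset (Key b c)}
    (hV : ∀ x ∈ V, π.Sub x) (T : MixedTables b r c d) (q : PairOn s V (Bits r))
    [∀ N : MixedTables b r c 1, Decidable (restrictPair V (mix π.positionsᶜ t 0 T N).hash
      (mix π.positionsᶜ t 0 T N).sign = q)] :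
    ∑ N : MixedTables b r c 1, (if restrictPair V (mix π.positionsᶜ t 0 T N).hash
      (mix π.positionsᶜ t 0 T N).sign = q then (1 : ℝ) else 0) =
    Fintype.card (MixedTables b r c 1) * offsetLaw π.positionsᶜ (T.hashOffset π.positionsᶜ t)
      (T.signOffset π.positionsᶜ t) V q := by
  classical
  have hN : (Fintype.card (MixedTables b r c 1) : ℝ) ≠ 0 := by
    exact_mod_cast Fintype.card_ne_zero
  -- All keys in `V` agree on the positions of `π`, so those positions contribute one constant `v`
  -- to the derived character; translating the table `h₃` by `v` preserves its distribution.
  obtain ⟨v, hv⟩ : ∃ v : Bits b, ∀ x ∈ V, T.hash2 (π.positionsᶜ)ᶜ x t = v := by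
    rw [compl_compl]
    rcases V.eq_empty_or_nonempty with rfl | ⟨y, hy⟩
    · exact ⟨0, by simp⟩
    · exact ⟨T.hash2 π.positions y t, fun x hx => by rw [hash2_positions_eq (hV x hx) (hV y hy)]⟩
  rw [offsetLaw, tablesMeasure_real_eq, mul_inv_cancel_left₀ hN]
  refine Eq.trans ?_ ((shiftDerEquiv v).sum_comp _)
  refine Finset.sum_congr rfl fun N _ => ?_
  have h1 : restrictPair V (mix π.positionsᶜ t 0 T N).hash (mix π.positionsᶜ t 0 T N).sign =
      restrictPair V (fun (i : Fin s) x => T.hashOffset π.positionsᶜ t i x +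
        ((shiftDerEquiv v N).hash1 π.positionsᶜ x + (shiftDerEquiv v N).hash3 .univ
          (fun k => (shiftDerEquiv v N).hash2 π.positionsᶜ x k + bitsOf b i)))
      (fun i x => T.signOffset π.positionsᶜ t i x *
        ((shiftDerEquiv v N).sign1 π.positionsᶜ x * (shiftDerEquiv v N).sign3 .univ
          (fun k => (shiftDerEquiv v N).hash2 π.positionsᶜ x k + bitsOf b i))) := by
    refine Prod.ext ?_ ?_
    · ext1 i; ext1 x
      simp only [restrictPair, hash_mix_eq_shiftDer, hv x.1 x.2]
      rfl
    · ext1 i; ext1 x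
      simp only [restrictPair, sign_mix_eq_shiftDer, hv x.1 x.2]
      rfl
  simp only [h1, Set.mem_ofPred_eq]
  congr!

/-- The exchange `(T, F) ↦ (mix T F, mix F T)` preserves the measure and the set of keys, and
carries the original pair to the overlined one. -/
theorem sameLawOn_keySet (s : ℕ) (J : Finset (Fin c)) (π : PartialKey b c) (τ : Prefix b d) :
    SameLawOn (s := s) (pairMeasure b r c d) (fun ω => keySet π τ ω.1)
      (fun ω => ω.1.decHash ω.1 J τ.1) (fun ω => ω.1.decSign ω.1 J τ.1)
      (fun ω => ω.1.decHash ω.2 J τ.1) (fun ω => ω.1.decSign ω.2 J τ.1) := by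
  classical
  intro V g
  rw [← ENNReal.toReal_eq_toReal_iff' (measure_ne_top _ _) (measure_ne_top _ _),
    ← measureReal_def, ← measureReal_def, pairMeasure_real_eq, pairMeasure_real_eq]
  congr 1
  have h := sum_sum_resample (fun T F : MixedTables b r c d => mix J τ.1 τ.1 T F)
    (fun T F => mix J τ.1 τ.1 F T) (fun T F => mix_mix J τ.1 τ.1 T F)
    (fun T F => mix_mix J τ.1 τ.1 F T)
    (fun T _ => if keySet π τ T = V ∧ restrictPair V (T.hash : Fin s → _) T.sign = g
      then (1 : ℝ) else 0)
  simp only [keySet_mix] at h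
  rw [Fintype.sum_prod_type, Fintype.sum_prod_type]
  simp only [Set.mem_ofPred_eq, decHash_eq_hash_mix, decSign_eq_sign_mix, mix_self]
  exact h.symm

theorem isOffsetMixedTabulation_keySet {s : ℕ} (π : PartialKey b c) (τ : Prefix b d)
    (V : Finset (Key b c)) (g : PairOn s V (Bits r))
    (h : pairMeasure b r c d {ω | keySet π τ ω.1 = V ∧
      restrictPair V (ω.1.decHash ω.2 π.positionsᶜ τ.1) (ω.1.decSign ω.2 π.positionsᶜ τ.1) = g} ≠ 0) :
    IsOffsetMixedTabulation V (fun q : PairOn s V (Bits r) => ((pairMeasure b r c d)[|{ω | keySet π τ ω.1 = V ∧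
      restrictPair V (ω.1.decHash ω.2 π.positionsᶜ τ.1)
        (ω.1.decSign ω.2 π.positionsᶜ τ.1) = g}]).real
      {ω | restrictPair V (ω.1.decHash ω.1 π.positionsᶜ τ.1)
        (ω.1.decSign ω.1 π.positionsᶜ τ.1) = q}) := by
  classical
  simp only [decHash_eq_hash_mix, decSign_eq_sign_mix, mix_self] at h ⊢
  set E : Set (MixedTables b r c d × MixedTables b r c d) := {ω | keySet π τ ω.1 = V ∧
    restrictPair V (mix π.positionsᶜ τ.1 τ.1 ω.1 ω.2).hash
      (mix π.positionsᶜ τ.1 τ.1 ω.1 ω.2).sign = g} with hE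
  obtain ⟨ω₀, hω₀⟩ := nonempty_of_measure_ne_zero h
  have hV : ∀ x ∈ V, π.Sub x := fun x hx => by
    rw [← hω₀.1, mem_keySet] at hx
    exact hx.1
  refine ⟨π, hV, ?_⟩
  set S : Finset (MixedTables b r c d × MixedTables b r c d) :=
    Finset.univ.filter fun ω => ω ∈ E with hS
  have hS0 : (S.card : ℝ) ≠ 0 := by
    have : ω₀ ∈ S := by simp [hS, hω₀]
    exact_mod_cast (Finset.card_pos.2 ⟨_, this⟩).ne'
  have hΩ : (Fintype.card (MixedTables b r c d × MixedTables b r c d) : ℝ) ≠ 0 := by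
    exact_mod_cast Fintype.card_ne_zero
  have hN : (Fintype.card (MixedTables b r c 1) : ℝ) ≠ 0 := by
    exact_mod_cast Fintype.card_ne_zero
  -- The conditioning event reads the exchanged block from `F` only, so replacing that block of `T`
  -- by fresh tables `N` does not affect it.
  have hmix : ∀ (T F : MixedTables b r c d) (N : MixedTables b r c 1),
      ((mix π.positionsᶜ τ.1 0 T N, F) ∈ E) = ((T, F) ∈ E) := fun T F N => by
    simp only [hE, Set.mem_ofPred_eq, keySet_mix, mix_mix_left]
  have key : ∀ q : PairOn s V (Bits r),
      ∑ ω : MixedTables b r c d × MixedTables b r c d,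
        (if ω ∈ E ∧ restrictPair V ω.1.hash ω.1.sign = q then (1 : ℝ) else 0) =
      ∑ ω ∈ S, offsetLaw π.positionsᶜ (ω.1.hashOffset π.positionsᶜ τ.1)
        (ω.1.signOffset π.positionsᶜ τ.1) V q := by
    intro q
    rw [hS, Finset.sum_filter, Fintype.sum_prod_type_right, Fintype.sum_prod_type_right]
    refine Finset.sum_congr rfl fun F _ => mul_left_cancel₀ hN ?_
    have h1 := sum_sum_resample
      (fun (T : MixedTables b r c d) (N : MixedTables b r c 1) => mix π.positionsᶜ τ.1 0 T N)
      (fun T N => mix π.positionsᶜ 0 τ.1 N T) (fun T N => mix_mix π.positionsᶜ τ.1 0 T N)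
      (fun T N => mix_mix π.positionsᶜ 0 τ.1 N T)
      (fun T _ => if (T, F) ∈ E ∧ restrictPair V T.hash T.sign = q then (1 : ℝ) else 0)
    simp only [hmix, Finset.sum_const, Finset.card_univ, nsmul_eq_mul, ← Finset.mul_sum] at h1
    rw [← h1, Finset.mul_sum]
    refine Finset.sum_congr rfl fun T _ => ?_
    by_cases hT : (T, F) ∈ E
    · simp only [hT, true_and, if_true]
      exact sum_mix_eq_offsetLaw π τ.1 hV T q
    · simp [hT]
  -- The conditional law is the uniform mixture, over the outcomes in the event, of the offset laws
  -- they determine.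
  have hlaw : (fun q : PairOn s V (Bits r) => ((pairMeasure b r c d)[|E]).real
      {ω | restrictPair V ω.1.hash ω.1.sign = q}) =
      ∑ ω ∈ S, (S.card : ℝ)⁻¹ • offsetLaw π.positionsᶜ (ω.1.hashOffset π.positionsᶜ τ.1)
        (ω.1.signOffset π.positionsᶜ τ.1) V := by
    ext1 q
    rw [measureReal_def, cond_apply (Set.toFinite E).measurableSet, ENNReal.toReal_mul,
      ENNReal.toReal_inv, ← measureReal_def, ← measureReal_def, pairMeasure_real_eq, pairMeasure_real_eq]
    simp only [Finset.sum_apply, Pi.smul_apply, smul_eq_mul, ← Finset.mul_sum, ← key]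
    simp only [Set.mem_inter_iff, Set.mem_ofPred_eq, Finset.sum_boole]
    rw [mul_inv, inv_inv, mul_comm (Fintype.card _ : ℝ), mul_assoc, mul_inv_cancel_left₀ hΩ]
    congr!
  rw [hlaw]
  refine (convex_convexHull ℝ _).sum_mem (fun _ _ => by positivity) ?_
    fun ω _ => subset_convexHull ℝ _ ⟨_, _, rfl⟩
  rw [Finset.sum_const, nsmul_eq_mul, mul_inv_cancel₀ hS0]

end SparseJL

/-! ### Assembly of the three statements. -/

open MeasureTheory SparseJL in
theorem mainTheorem6 (b r c d s m : ℕ) (hc : 1 ≤ c) (hd : 1 ≤ d)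
    (hs : 1 ≤ s) (hsb : s ≤ 2 ^ b) (hm : m = s * 2 ^ r)
    (p ε : ℝ) (hp : 2 ≤ p) (hε : 0 < ε) :
    -- the tail bound, both for `J π = I_π` and for the complement `J π = [c] \ I_π`
    (∀ J : PartialKey b c → Finset (Fin c),
      (J = fun π => π.positions) ∨ (J = fun π => π.positionsᶜ) →
      ∀ w : Key b c → ℝ, ∑ x, w x ^ 2 = 1 →
        (pairMeasure b r c d).real {ω | ε ≤ |errorZ (s := s) ω.1.hash ω.1.sign w|} ≤
          (ε⁻¹ * ∑ π : PartialKey b c, ∑ τ : Prefix b d, (4 : ℝ) ^ (c + 4) / s *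
            pNorm (pairMeasure b r c d) p (fun ω => decoupledSum (s := s) (keySet π τ ω.1)
              (ω.1.decHash ω.1 (J π) τ.1) (ω.1.decSign ω.1 (J π) τ.1)
              (ω.1.decHash ω.2 (J π) τ.1) (ω.1.decSign ω.2 (J π) τ.1) w)) ^ p
          + 4 * (ε ^ 2)⁻¹ * 3 ^ c * ((s : ℝ) / m) * (((2 : ℝ) ^ b) ^ d)⁻¹) ∧
    -- the multiplicity bound
    (∀ (T : MixedTables b r c d) (w : Key b c → ℝ),
      ∑ π : PartialKey b c, ∑ τ : Prefix b d, ∑ x ∈ keySet π τ T, w x ^ 2 ≤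
        d * 2 ^ c * ∑ x, w x ^ 2) ∧
    -- the decoupling-decomposition
    (∀ P : PairProperty s (Key b c) (Bits r),
      (∀ V f, IsOffsetMixedTabulation V f → P V f) →
      IsDecouplingDecomposition (pairMeasure b r c d)
        (fun ω => ω.1.hash) (fun ω => ω.1.sign) P ε p ((4 : ℝ) ^ (c + 2))
        (4 * (ε ^ 2)⁻¹ * 3 ^ c * ((s : ℝ) / m) * (((2 : ℝ) ^ b) ^ d)⁻¹)
        (fun (α : PartialKey b c × Prefix b d) ω => keySet α.1 α.2 ω.1)) := by
  -- `m = s 2^r` turns `2^{-r}` into `s / m`.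
  have hγ : 4 * (ε ^ 2)⁻¹ * (3 ^ c * ((2 : ℝ) ^ r * (2 ^ b) ^ d)⁻¹) =
      4 * (ε ^ 2)⁻¹ * 3 ^ c * ((s : ℝ) / m) * (((2 : ℝ) ^ b) ^ d)⁻¹ := by
    have hs0 : (s : ℝ) ≠ 0 := by positivity
    rw [hm]
    push_cast
    field_simp
  have hp1 : 1 ≤ p := by linarith
  have hp0 : 0 ≤ p := by linarith
  have hcompl := fun w hw => pairMeasure_real_errorZ_le (r := r) (d := d) hp1 hε hs
    (fun π : PartialKey b c => π.positionsᶜ) Finset.univ w hw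
    fun T => quadSum_univ_eq_sum_commonKey s T w
  have hpos := fun w hw => pairMeasure_real_errorZ_le (r := r) (d := d) hp1 hε hs
    (fun π : PartialKey b c => π.positions) _ w hw fun T => quadSum_univ_eq_sum_prefix s T w
  have h4 : (4 : ℝ) ^ (c + 2) ≤ 4 ^ (c + 4) := pow_le_pow_right₀ (by norm_num) (by omega)
  refine ⟨?_, fun T w => (sum_sum_keySet_eq T w).le, fun P hP => ?_⟩
  -- Norms are nonnegative, so a bound over a subfamily `S` with the smaller constant implies the
  -- stated one; for `J π = I_π` the subfamily has only the empty `π`.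
  · have mono : ∀ (S : Finset (PartialKey b c × Prefix b d))
        (X : PartialKey b c × Prefix b d → MixedTables b r c d × MixedTables b r c d → ℝ),
        (ε⁻¹ * ∑ α ∈ S, (4 : ℝ) ^ (c + 2) / s * pNorm (pairMeasure b r c d) p (X α)) ^ p ≤
        (ε⁻¹ * ∑ π : PartialKey b c, ∑ τ : Prefix b d, (4 : ℝ) ^ (c + 4) / s *
          pNorm (pairMeasure b r c d) p (X (π, τ))) ^ p := by
      intro S X
      have h0 : ∀ α, 0 ≤ pNorm (pairMeasure b r c d) p (X α) := fun α => pNorm_nonneg _ _ _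
      rw [← Fintype.sum_prod_type' (f := fun π τ => (4 : ℝ) ^ (c + 4) / s *
        pNorm (pairMeasure b r c d) p (X (π, τ)))]
      refine Real.rpow_le_rpow (mul_nonneg (by positivity) (Finset.sum_nonneg fun α _ =>
        mul_nonneg (by positivity) (h0 α))) (mul_le_mul_of_nonneg_left ?_ (by positivity)) hp0
      refine (Finset.sum_le_univ_sum_of_nonneg fun α =>
        mul_nonneg (by positivity) (h0 α)).trans (Finset.sum_le_sum fun α _ => ?_)
      exact mul_le_mul_of_nonneg_right (by gcongr) (h0 α)
    rintro J (rfl | rfl) w hw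
    · rw [← hγ]
      exact (hpos w hw).trans (add_le_add_left (mono _ _) _)
    · rw [← hγ]
      exact (hcompl w hw).trans (add_le_add_left (mono _ _) _)
  · refine ⟨fun α ω => ω.1.decHash ω.1 α.1.positionsᶜ α.2.1,
      fun α ω => ω.1.decSign ω.1 α.1.positionsᶜ α.2.1,
      fun α ω => ω.1.decHash ω.2 α.1.positionsᶜ α.2.1,
      fun α ω => ω.1.decSign ω.2 α.1.positionsᶜ α.2.1, fun w hw => ?_,
      fun α => sameLawOn_keySet s α.1.positionsᶜ α.1 α.2,
      fun α V g h => hP _ _ (isOffsetMixedTabulation_keySet α.1 α.2 V g h)⟩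
    rw [← hγ]
    exact hcompl w hw
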